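/- Let $p\geq 3$ be a prime. Write $t=p^{-s}$ and $\zeta_p(s)=(1-p^{-s})^{-1}$, so that $\zeta_{\mathbb{Z}_p^3}(s)=\zeta_p(s)\zeta_p(s-1)\zeta_p(s-2)$. For a $\mathbb{Z}_p$-Lie algebra $L$, additively isomorphic to $\mathbb{Z}_p^3$, put $\zeta_L(s)=\sum_{H\leq L}|L:H|^{-s}$, the sum being over all subalgebras $H$ of finite index. If $(e_1,e_2,e_3)$ is a basis of $L$ with $[e_i,e_j]=\sum_k\lambda_{ij}^k e_k$, put $L_{ij}(\mathbf{x})=\sum_k\lambda_{ij}^kx_k$; the quadratic form of $L$ with respect to this basis is $f(\mathbf{x})=L_{23}(\mathbf{x})x_1-L_{13}(\mathbf{x})x_2+L_{12}(\mathbf{x})x_3$. For $*\in\{\text{square},\text{non-square}\}$ and $k\in\mathbb{N}_0$ say that $d\in\mathbb{Z}_p$ is of type $(*,k)$ if $d=p^ku^2$ with $u\in\mathbb{Z}_p^*$ (when $*$ is "square"), respectively $d=p^k\rho$ with $\rho\in\mathbb{Z}_p^*$ a non-square modulo $p$ (when $*$ is "non-square"). Define functions $Z_{*,k}(s)$, rational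 in $t=p^{-s}$, by $$Z_{\text{square},0}(s)=\left(\frac{1-p^{-1}}{1-p^{-1}t}\right)^2,\quad Z_{\text{non-square},0}(s)=\frac{1-p^{-2}}{1-p^{-2}t^2},\quad Z_{*,1}(s)=\frac{1-p^{-1}}{1-p^{-1}t},$$ $$Z_{*,k+2}(s)=p^{-1}t^2Z_{*,k}(s)+1-p^{-1}\qquad(k\geq 0).$$ Let $i\in\mathbb{N}_0$ and let $L=\mathbb{Z}_pe_1\oplus\mathbb{Z}_pe_2\oplus\mathbb{Z}_pe_3$ be the soluble $\mathbb{Z}_p$-Lie algebra with $[e_2,e_3]=0$ and with one of the following further relations: (D) $[e_1,e_2]=-p^i(e_2+p^rd\,e_3)$, $[e_1,e_3]=-p^i(p^re_2+e_3)$, where $r\geq 1$, $d\in\mathbb{Z}_p$, $d\neq 0$; (E) $[e_1,e_2]=-p^i d\,e_3$, $[e_1,e_3]=-p^i(e_2+p^re_3)$, where $r\geq 0$, $d\in\mathbb{Z}_p$, $p^{2r}+4d\neq 0$; (F) $[e_1,e_2]=-p^{i+r}e_3$, $[e_1,e_3]=-p^ie_2$, where $r\geq 0$; (G) $[e_1,e_2]=-p^{i+r}\rho\,e_3$,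 $[e_1,e_3]=-p^ie_2$, where $r\geq 0$ and $\rho\in\mathbb{Z}_p^*$ is a non-square modulo $p$. Then there are $*\in\{\text{square},\text{non-square}\}$ and $k,\iota\in\mathbb{N}_0$ with the following properties. 1. With respect to a suitable basis of $L$ the quadratic form of $L$ is $p^\iota(x_2^2-dx_3^2)$ for some $d$ of type $(*,k)$. For every $d\in\mathbb{Z}_p$ of type $(*,k)$ and every $s$ with $\mathrm{Re}(s)>-1$, Igusa's integral $\int_{\mathbb{Z}_p^2}|x^2-dy^2|_p^s\,\mathrm{d}\mu$ (for the Haar measure $\mu$ of total mass $1$) converges absolutely and equals $Z_{*,k}(s)$. 2. The abscissa of convergence of $\zeta_L(s)$ is $1$, the series converges absolutely for $\mathrm{Re}(s)>1$, and $\zeta_L(s)$ has a meromorphic continuation to $\mathbb{C}$, which is given by $$\zeta_L(s)=\zeta_{\mathbb{Z}_p^3}(s)-Z_{*,k}(s-2)\,\zeta_p(2s-2)\,\zeta_p(s-2)\,p^{(2-s)(\iota+1)}(1-p^{-1})^{-1}.$$ 3. If $*$ is "square" and $k$ is even, then $\zeta_L(s)$ has a triple pole at $s=1$. In all other cases $\zeta_L(s)$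 has a double pole at $s=1$. -/

import Mathlib

open Filter Topology MeasureTheory

namespace PadicLie

noncomputable section

/-! ### Subalgebra zeta functions -/

section Zeta

variable (p : ℕ) [Fact p.Prime] (L : Type*) [LieRing L] [LieAlgebra ℤ_[p] L]

/-- The index `|L : H|` of a subalgebra `H`; it is `0` when the index is infinite. -/
def subIndex (H : LieSubalgebra ℤ_[p] L) : ℕ :=
  H.toSubmodule.toAddSubgroup.index

/-- The subalgebras of finite index. -/
abbrev FiniteIndexSubalgebra : Type _ :=
  {H : LieSubalgebra ℤ_[p] L // subIndex p L H ≠ 0}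

/-- The summand `|L : H|^{-s}`. -/
def zetaTerm (s : ℂ) (H : FiniteIndexSubalgebra p L) : ℂ :=
  (subIndex p L H.1 : ℂ) ^ (-s)

/-- The subalgebra zeta function `ζ_L(s) = ∑_{H ≤ L} |L : H|^{-s}`. -/
def subalgebraZeta (s : ℂ) : ℂ :=
  ∑' H : FiniteIndexSubalgebra p L, zetaTerm p L s H

/-- The number of subalgebras of index `n`. -/
def subalgebraCount (n : ℕ) : ℕ :=
  Nat.card {H : LieSubalgebra ℤ_[p] L // subIndex p L H = n}

end Zeta

/-- `α` is the abscissa of convergence of the Dirichlet series `∑_{n ≥ 1} a_n n^{-s}`: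
the partial sums converge for `Re s > α` and diverge for `Re s < α`. -/
def IsAbscissaOfConvergence (a : ℕ → ℂ) (α : ℝ) : Prop :=
  (∀ s : ℂ, α < s.re →
    ∃ l : ℂ, Tendsto (fun N : ℕ => ∑ n ∈ Finset.Icc 1 N, a n * (n : ℂ) ^ (-s)) atTop (𝓝 l)) ∧
  (∀ s : ℂ, s.re < α →
    ¬ ∃ l : ℂ, Tendsto (fun N : ℕ => ∑ n ∈ Finset.Icc 1 N, a n * (n : ℂ) ^ (-s)) atTop (𝓝 l))

/-! ### Igusa's local zeta function -/

instance padicIntMeasurableSpace (p : ℕ) [Fact p.Prime] : MeasurableSpace ℤ_[p] := borel _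

instance padicIntBorelSpace (p : ℕ) [Fact p.Prime] : BorelSpace ℤ_[p] := ⟨rfl⟩

/-- The additive Haar measure on `ℤ_p` of total mass one. -/
def haarOne (p : ℕ) [Fact p.Prime] : Measure ℤ_[p] :=
  Measure.addHaarMeasure (⊤ : TopologicalSpace.PositiveCompacts ℤ_[p])

/-- The additive Haar measure on `ℤ_pⁿ` of total mass one. -/
def haarPow (p : ℕ) [Fact p.Prime] (n : ℕ) : Measure (Fin n → ℤ_[p]) :=
  Measure.pi (fun _ => haarOne p)

/-- The integrand `|f(x)|_p^s`. -/
def igusaIntegrand {p : ℕ} [Fact p.Prime] {n : ℕ} (f : MvPolynomial (Fin n) ℤ_[p]) (s : ℂ)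
    (x : Fin n → ℤ_[p]) : ℂ :=
  ((‖MvPolynomial.eval x f‖ : ℝ) : ℂ) ^ s

/-- Igusa's local zeta function `Z_f(s) = ∫_{ℤ_pⁿ} |f(x)|_p^s dμ`, where this converges. -/
def igusaZeta {p : ℕ} [Fact p.Prime] {n : ℕ} (f : MvPolynomial (Fin n) ℤ_[p]) (s : ℂ) : ℂ :=
  ∫ x, igusaIntegrand f s x ∂(haarPow p n)

/-- The binary form `x² - d y²`. -/
def binaryForm {p : ℕ} [Fact p.Prime] (d : ℤ_[p]) : MvPolynomial (Fin 2) ℤ_[p] :=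
  MvPolynomial.X 0 ^ 2 - MvPolynomial.C d * MvPolynomial.X 1 ^ 2

/-- The symbol `∗`. -/
inductive Star : Type
  | square
  | nonsquare

/-- `d` is of type `(∗, k)`: `d = p^k u²` with `u` a unit if `∗` is "square", and `d = p^k ρ` with
`ρ` a unit that is a non-square modulo `p` if `∗` is "non-square". -/
def HasType {p : ℕ} [Fact p.Prime] (d : ℤ_[p]) : Star → ℕ → Prop
  | .square, k => ∃ u : ℤ_[p], IsUnit u ∧ d = (p : ℤ_[p]) ^ k * u ^ 2
  | .nonsquare, k => ∃ ρ : ℤ_[p], IsUnit ρ ∧ ¬ IsSquare (PadicInt.toZMod ρ) ∧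
      d = (p : ℤ_[p]) ^ k * ρ

/-- The explicit functions `Z_{∗,k}`, as meromorphic functions on `ℂ`; here `t = p^{-s}`. -/
def explicitZ (p : ℕ) (star : Star) : ℕ → ℂ → ℂ
  | 0, s =>
    match star with
    | .square => ((1 - (p : ℂ)⁻¹) / (1 - (p : ℂ)⁻¹ * (p : ℂ) ^ (-s))) ^ 2
    | .nonsquare =>
      (1 - ((p : ℂ) ^ 2)⁻¹) / (1 - ((p : ℂ) ^ 2)⁻¹ * ((p : ℂ) ^ (-s)) ^ 2)
  | 1, s => (1 - (p : ℂ)⁻¹) / (1 - (p : ℂ)⁻¹ * (p : ℂ) ^ (-s))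
  | k + 2, s =>
    (p : ℂ)⁻¹ * ((p : ℂ) ^ (-s)) ^ 2 * explicitZ p star k s + 1 - (p : ℂ)⁻¹

/-- The local Riemann zeta function `ζ_p(s) = (1 - p^{-s})⁻¹`. -/
def localZeta (p : ℕ) (s : ℂ) : ℂ := (1 - (p : ℂ) ^ (-s))⁻¹

/-- `ζ_{ℤ_p³}(s) = ζ_p(s) ζ_p(s-1) ζ_p(s-2)`. -/
def abelianZeta (p : ℕ) (s : ℂ) : ℂ :=
  localZeta p s * localZeta p (s - 1) * localZeta p (s - 2)

/-- The function
`ζ_{ℤ_p³}(s) - Z_{∗,k}(s-2) ζ_p(2s-2) ζ_p(s-2) p^{(2-s)(ι+1)} (1-p^{-1})^{-1}`. -/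
def zetaFormula (p : ℕ) (star : Star) (k ι : ℕ) (s : ℂ) : ℂ :=
  abelianZeta p s -
    explicitZ p star k (s - 2) * localZeta p (2 * s - 2) * localZeta p (s - 2) *
      (p : ℂ) ^ ((2 - s) * ((ι : ℂ) + 1)) * (1 - (p : ℂ)⁻¹)⁻¹

/-! ### The families D to G of soluble Lie algebras -/

/-- The parameters of the families D, E, F, G, i.e. of the Lie algebras `L₂(0,r,d)` (`r ≥ 1`),
`L₃(0,r,d)`, `L₄(0,r)` and `L₅(0,r)`; the unit `ρ` in the last is a non-square modulo `p`. -/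
inductive SolubleFamily (p : ℕ) [Fact p.Prime] : Type
  | famD (r : ℕ) (hr : 1 ≤ r) (d : ℤ_[p])
  | famE (r : ℕ) (d : ℤ_[p])
  | famF (r : ℕ)
  | famG (r : ℕ) (ρ : ℤ_[p]) (hunit : IsUnit ρ) (hns : ¬ IsSquare (PadicInt.toZMod ρ))

namespace SolubleFamily

variable {p : ℕ} [Fact p.Prime]

/-- The matrix `M` for which `[e₁,e₂] = -(M₀₀ e₂ + M₀₁ e₃)` and
`[e₁,e₃] = -(M₁₀ e₂ + M₁₁ e₃)`. -/
def relMatrix : SolubleFamily p → Matrix (Fin 2) (Fin 2) ℤ_[p]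
  | famD r _ d => !![1, (p : ℤ_[p]) ^ r * d; (p : ℤ_[p]) ^ r, 1]
  | famE r d => !![0, d; 1, (p : ℤ_[p]) ^ r]
  | famF r => !![0, (p : ℤ_[p]) ^ r; 1, 0]
  | famG r ρ _ _ => !![0, (p : ℤ_[p]) ^ r * ρ; 1, 0]

/-- The associated quadratic form `p^r (x₂² - d x₃²)`, `x₂² + p^r x₂x₃ - d x₃²`, `x₂² - p^r x₃²`
or `x₂² - p^r ρ x₃²` has non-zero discriminant. -/
def Nondegenerate : SolubleFamily p → Prop
  | famD _ _ d => d ≠ 0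
  | famE r d => (p : ℤ_[p]) ^ (2 * r) + 4 * d ≠ 0
  | famF _ => True
  | famG _ _ _ _ => True

/-- `L` is the Lie algebra obtained from the given member of the families by multiplying its
matrix of relations by `p^i`. -/
def IsMember (φ : SolubleFamily p) (i : ℕ) (L : Type*) [LieRing L] [LieAlgebra ℤ_[p] L] : Prop :=
  ∃ e : Module.Basis (Fin 3) ℤ_[p] L,
    ⁅e 0, e 1⁆ = -(((p : ℤ_[p]) ^ i * φ.relMatrix 0 0) • e 1 +
      ((p : ℤ_[p]) ^ i * φ.relMatrix 0 1) • e 2) ∧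
    ⁅e 0, e 2⁆ = -(((p : ℤ_[p]) ^ i * φ.relMatrix 1 0) • e 1 +
      ((p : ℤ_[p]) ^ i * φ.relMatrix 1 1) • e 2) ∧
    ⁅e 1, e 2⁆ = 0

end SolubleFamily

/-! ### The ternary quadratic form of a three-dimensional Lie algebra -/

section Form

variable {p : ℕ} [Fact p.Prime] {L : Type*} [LieRing L] [LieAlgebra ℤ_[p] L]

/-- The linear form `L_{ij}(y) = ∑_k λ_{ij}^k y_k` given by the structure constants of `L`. -/
def structForm (e : Module.Basis (Fin 3) ℤ_[p] L) (i j : Fin 3) : MvPolynomial (Fin 3) ℤ_[p] :=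
  ∑ k : Fin 3, MvPolynomial.C (e.repr ⁅e i, e j⁆ k) * MvPolynomial.X k

/-- The ternary quadratic form `L₂₃(x) x₁ - L₁₃(x) x₂ + L₁₂(x) x₃` of `L` with respect to a basis;
the indices `0, 1, 2` stand for `1, 2, 3`. -/
def ternaryForm (e : Module.Basis (Fin 3) ℤ_[p] L) : MvPolynomial (Fin 3) ℤ_[p] :=
  structForm e 1 2 * MvPolynomial.X 0 - structForm e 0 2 * MvPolynomial.X 1 +
    structForm e 0 1 * MvPolynomial.X 2

end Form

end

end PadicLie

namespace PadicLie

noncomputable section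

/-! ### Divisibility, units and square classes in `ℤ_[p]` -/

section PadicBasics

variable {p : ℕ} [Fact p.Prime]

/-! In each family a suitable basis makes `e 1, e 2` span an abelian ideal on which `ad (e 0)` acts
as `a - p^ι N`, where `N (u₁, u₂) = (u₂, d u₁)`. For family E this needs completing the square;
elsewhere the given basis serves (`exists_normalBasis`). The scalar `a` preserves every lattice, so
neither the quadratic form nor the subalgebras depend on it.

A subalgebra of finite index is determined by its image `p^n ℤ_p` in the coordinate 0, its
intersection `Λ` with the plane, and the coset of `Λ` lying over `p^n`. Such a triple gives a
subalgebra exactly when `p^(n+ι) N Λ ⊆ Λ` (`IsNormalBasis.exists_equiv`). Write `Λ = p^m Λ'`, with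
`Λ'` given by a point of the projective line over `ℤ/p^l`. The index is `p^(n+2m+l)`, there are
`p^(2m+l)` cosets, and the condition does not involve `m`. It is void if `l ≤ n + ι`; otherwise it
selects the points `[1 : x]` with `x² ≡ d` modulo `p^(l-n-ι)` (`compatible_inl_iff`,
`compatible_inr_iff`).

Let `ν_j` be the measure of `{x | x² ≡ d mod p^j}`. It depends only on the type of `d` and is
computed by a recursion that lowers both `k` and `j` by 2 (`HasType.density`). With `T = p^(-s)`,
summing the geometric series over `m` and `n` expresses the zeta function through `P = ∑ ν_j t^j` at
`t = p² T` (`hasSum_subalgebraFiber`). The same `P` governs Igusa's integral: integrating over `x`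
and then over the shells of `y` gives `Z_{∗,k}` as a function of `P` (`exists_hasSum_sqDensity`,
`hasSum_sqZeta_shift`). Eliminating `P` yields the formula (`zetaFormula_algebra`).

Absolute convergence for `Re s > 1` comes with the summation. For `Re s < 1` the `p^(2m)`
subalgebras attached to the lattices `p^m ℤ_p²` prevent the terms of the Dirichlet series from
tending to 0. At `s = 1` the recursion for `Z_{∗,k}` preserves the order of the pole, which is 2 for
squares with even `k` and 1 otherwise; `ζ_p(2s-2)` adds one more, while `ζ_{ℤ_p³}` has only a simple
pole there (`order_zetaFormula`). -/

lemma toZModPow_eq_zero_iff {l : ℕ} {x : ℤ_[p]} :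
    PadicInt.toZModPow l x = 0 ↔ (p : ℤ_[p]) ^ l ∣ x := by
  rw [← RingHom.mem_ker, PadicInt.ker_toZModPow, Ideal.mem_span_singleton]

lemma toZModPow_eq_iff {l : ℕ} {x y : ℤ_[p]} :
    PadicInt.toZModPow l x = PadicInt.toZModPow l y ↔ (p : ℤ_[p]) ^ l ∣ x - y := by
  rw [← toZModPow_eq_zero_iff, map_sub, sub_eq_zero]

lemma toZModPow_surjective (l : ℕ) :
    Function.Surjective (PadicInt.toZModPow l : ℤ_[p] →+* ZMod (p ^ l)) :=
  ZMod.ringHom_surjective _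

lemma p_ne_zero : (p : ℤ_[p]) ≠ 0 := NeZero.ne _

lemma toZMod_eq_zero_iff {x : ℤ_[p]} : PadicInt.toZMod x = 0 ↔ (p : ℤ_[p]) ∣ x := by
  rw [← RingHom.mem_ker, PadicInt.ker_toZMod, PadicInt.maximalIdeal_eq_span_p,
    Ideal.mem_span_singleton]

lemma isUnit_iff_not_p_dvd {x : ℤ_[p]} : IsUnit x ↔ ¬ (p : ℤ_[p]) ∣ x := by
  rw [PadicInt.isUnit_iff, ← PadicInt.norm_lt_one_iff_dvd, not_lt]
  exact ⟨fun h => h.ge, fun h => le_antisymm x.norm_le_one h⟩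

lemma isUnit_two (hp : 3 ≤ p) : IsUnit (2 : ℤ_[p]) := by
  rw [isUnit_iff_not_p_dvd, ← PadicInt.norm_lt_one_iff_dvd]
  have := PadicInt.norm_int_lt_one_iff_dvd (p := p) 2
  push_cast at this
  rw [this]
  intro h
  have := Int.le_of_dvd (by norm_num) h
  omega

/-- Hensel's lemma for square roots of units. -/
lemma exists_sq_eq_of_isSquare (hp : 3 ≤ p) {ρ : ℤ_[p]} (hρ : IsUnit ρ)
    (hs : IsSquare (PadicInt.toZMod ρ)) : ∃ u : ℤ_[p], IsUnit u ∧ ρ = u ^ 2 := by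
  obtain ⟨b, hb⟩ := hs
  obtain ⟨a, rfl⟩ := ZMod.ringHom_surjective (PadicInt.toZMod : ℤ_[p] →+* ZMod p) b
  have h1 : (p : ℤ_[p]) ∣ a ^ 2 - ρ := by
    rw [← toZMod_eq_zero_iff, map_sub, map_pow, hb]; ring
  have ha : IsUnit a := by
    rw [isUnit_iff_not_p_dvd] at hρ ⊢
    intro h
    exact hρ ((dvd_sub_right (dvd_pow h two_ne_zero)).1 h1)
  have h2 : ‖(2 : ℤ_[p])‖ = 1 := PadicInt.isUnit_iff.1 (isUnit_two hp)
  obtain ⟨z, hz, -⟩ := hensels_lemma (p := p) (R := ℤ_[p])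
    (F := Polynomial.X ^ 2 - Polynomial.C ρ) (a := a) (by
      simp only [map_sub, map_pow, Polynomial.aeval_X, Polynomial.aeval_C,
        Polynomial.derivative_X_pow, Polynomial.derivative_C, sub_zero, map_mul, map_natCast]
      simp only [Algebra.algebraMap_self, RingHom.id_apply, Nat.cast_ofNat, norm_mul, h2, norm_pow]
      rw [PadicInt.isUnit_iff.1 ha]
      simpa using (PadicInt.norm_lt_one_iff_dvd _).2 h1)
  have hz' : ρ = z ^ 2 := by
    simp only [map_sub, map_pow, Polynomial.aeval_X, Polynomial.aeval_C, Algebra.algebraMap_self,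
      RingHom.id_apply] at hz
    exact (sub_eq_zero.1 hz).symm
  refine ⟨z, ?_, hz'⟩
  rw [hz'] at hρ
  exact (isUnit_pow_iff two_ne_zero).1 hρ

lemma exists_hasType (hp : 3 ≤ p) {d : ℤ_[p]} (hd : d ≠ 0) : ∃ star k, HasType d star k := by
  have h := PadicInt.unitCoeff_spec hd
  by_cases hs : IsSquare (PadicInt.toZMod (PadicInt.unitCoeff hd : ℤ_[p]))
  · obtain ⟨u, hu, hu2⟩ := exists_sq_eq_of_isSquare hp (PadicInt.unitCoeff hd).isUnit hs
    exact ⟨.square, d.valuation, u, hu, by rw [← hu2, mul_comm]; exact h⟩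
  · exact ⟨.nonsquare, d.valuation, _, (PadicInt.unitCoeff hd).isUnit, hs, by
      rw [mul_comm]; exact h⟩

/-- A square factor shifts the valuation by an even amount and keeps the square class. This is what
makes the inner Igusa integral of `x² - d y²`, for fixed `y`, depend only on the valuation of `y`.
-/
lemma HasType.mul_sq {d : ℤ_[p]} {star : Star} {k : ℕ} (h : HasType d star k) {y : ℤ_[p]}
    (hy : y ≠ 0) : HasType (d * y ^ 2) star (k + 2 * y.valuation) := by
  have hv := PadicInt.unitCoeff_spec hy
  set v := PadicInt.unitCoeff hy
  cases star
  · obtain ⟨u, hu, rfl⟩ := h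
    refine ⟨u * v, hu.mul v.isUnit, ?_⟩
    conv_lhs => rw [hv]
    ring
  · obtain ⟨u, hu, hs, rfl⟩ := h
    refine ⟨u * v ^ 2, hu.mul (v.isUnit.pow 2), ?_, ?_⟩
    · rintro ⟨b, hb⟩
      apply hs
      have hv0 : PadicInt.toZMod (v : ℤ_[p]) ≠ 0 := by
        rw [Ne, toZMod_eq_zero_iff, ← isUnit_iff_not_p_dvd]
        exact v.isUnit
      refine ⟨b / PadicInt.toZMod (v : ℤ_[p]), ?_⟩
      rw [map_mul, map_pow] at hb
      field_simp
      rw [hb]; ring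
    · conv_lhs => rw [hv]
      ring

end PadicBasics

/-! ### Haar measure of residue classes -/

section Haar

variable {p : ℕ} [Fact p.Prime]

instance : (haarOne p).IsAddHaarMeasure := by unfold haarOne; infer_instance

instance : IsProbabilityMeasure (haarOne p) := ⟨by
  have := Measure.addHaarMeasure_self (G := ℤ_[p]) (K₀ := ⊤)
  simpa [haarOne] using this⟩

lemma measurableSet_dvd_sub (l : ℕ) (a : ℤ_[p]) :
    MeasurableSet {x : ℤ_[p] | (p : ℤ_[p]) ^ l ∣ x - a} := by
  have h : {x : ℤ_[p] | (p : ℤ_[p]) ^ l ∣ x - a} =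
      Metric.closedBall a ((p : ℝ) ^ (-l : ℤ)) := by
    ext x
    rw [Set.mem_ofPred_eq, ← Ideal.mem_span_singleton, ← PadicInt.norm_le_pow_iff_mem_span_pow,
      mem_closedBall_iff_norm]
  rw [h]
  exact Metric.isClosed_closedBall.measurableSet

lemma toZModPow_preimage_eq (l : ℕ) (S : Set (ZMod (p ^ l))) :
    (PadicInt.toZModPow l : ℤ_[p] → ZMod (p ^ l)) ⁻¹' S =
      ⋃ b : S, {x : ℤ_[p] | PadicInt.toZModPow l x = b} := by
  ext x; simp

lemma measurableSet_toZModPow_eq (l : ℕ) (b : ZMod (p ^ l)) :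
    MeasurableSet {x : ℤ_[p] | PadicInt.toZModPow l x = b} := by
  obtain ⟨a, rfl⟩ := toZModPow_surjective l b
  simp_rw [toZModPow_eq_iff]
  exact measurableSet_dvd_sub l a

lemma haarOne_real_translate (l : ℕ) (b : ZMod (p ^ l)) :
    (haarOne p).real {x : ℤ_[p] | PadicInt.toZModPow l x = b} =
      (haarOne p).real {x : ℤ_[p] | PadicInt.toZModPow l x = 0} := by
  obtain ⟨a, rfl⟩ := toZModPow_surjective l b
  have := measure_preimage_add (haarOne p) a
    {x : ℤ_[p] | PadicInt.toZModPow l x = PadicInt.toZModPow l a}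
  rw [measureReal_def, ← this, measureReal_def]
  congr 2
  ext x
  simp

lemma haarOne_real_preimage_eq_mul (l : ℕ) (S : Set (ZMod (p ^ l))) :
    (haarOne p).real ((PadicInt.toZModPow l : ℤ_[p] → ZMod (p ^ l)) ⁻¹' S) =
      Nat.card S * (haarOne p).real {x : ℤ_[p] | PadicInt.toZModPow l x = 0} := by
  classical
  have : Fintype S := Fintype.ofFinite S
  rw [toZModPow_preimage_eq, measureReal_iUnion_fintype]
  · simp_rw [haarOne_real_translate l]
    simp
  · intro b c hbc
    refine Set.disjoint_left.2 fun x hx hx' => hbc (Subtype.ext ?_)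
    exact (Set.mem_ofPred_eq ▸ hx).symm.trans hx'
  · exact fun b => measurableSet_toZModPow_eq l b.1

/-- All classes modulo `p^l` are translates of one another and there are `p^l` of them, so each has
measure `p^(-l)`. The identity is used in both directions: to measure sets and to count residues. -/
lemma haarOne_real_preimage (l : ℕ) (S : Set (ZMod (p ^ l))) :
    (haarOne p).real ((PadicInt.toZModPow l : ℤ_[p] → ZMod (p ^ l)) ⁻¹' S) =
      Nat.card S / (p : ℝ) ^ l := by
  have h := haarOne_real_preimage_eq_mul (p := p) l Set.univ
  have hp : (p : ℝ) ^ l ≠ 0 := pow_ne_zero _ (Nat.cast_ne_zero.2 (NeZero.ne p))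
  rw [Set.preimage_univ, probReal_univ, Nat.card_univ, Nat.card_zmod] at h
  rw [haarOne_real_preimage_eq_mul, eq_div_iff hp, mul_assoc]
  push_cast at h
  rw [mul_comm ((haarOne p).real _), ← h, mul_one]

lemma haarOne_real_dvd_sub (l : ℕ) (a : ℤ_[p]) :
    (haarOne p).real {x : ℤ_[p] | (p : ℤ_[p]) ^ l ∣ x - a} = ((p : ℝ) ^ l)⁻¹ := by
  have := haarOne_real_preimage (p := p) l {PadicInt.toZModPow l a}
  simp only [Set.preimage, Set.mem_singleton_iff, toZModPow_eq_iff] at this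
  simpa using this

lemma haarOne_real_dvd (l : ℕ) :
    (haarOne p).real {x : ℤ_[p] | (p : ℤ_[p]) ^ l ∣ x} = ((p : ℝ) ^ l)⁻¹ := by
  simpa using haarOne_real_dvd_sub (p := p) l 0

lemma haarOne_singleton (a : ℤ_[p]) : haarOne p {a} = 0 := by
  have h : (haarOne p).real {a} ≤ 0 := by
    refine ge_of_tendsto' (x := atTop) (f := fun l : ℕ => ((p : ℝ)⁻¹) ^ l)
      (tendsto_pow_atTop_nhds_zero_of_lt_one (by positivity)
        (inv_lt_one_of_one_lt₀ (Nat.one_lt_cast.2 (Fact.out : p.Prime).one_lt))) fun l => ?_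
    rw [inv_pow, ← haarOne_real_dvd_sub l a]
    exact measureReal_mono (by simp)
  exact (measureReal_eq_zero_iff).1 (le_antisymm h measureReal_nonneg)

instance : NullSingletonClass (haarOne p) := ⟨haarOne_singleton⟩

/-- Multiplication by `p` divides the Haar measure by `p`. -/
lemma haarOne_real_mul_p (S : Set ℤ_[p]) :
    (haarOne p).real ((fun x => (p : ℤ_[p]) * x) '' S) = (haarOne p).real S / p := by
  have hemb : Topology.IsClosedEmbedding (fun x : ℤ_[p] => (p : ℤ_[p]) * x) :=
    Continuous.isClosedEmbedding (by fun_prop) (mul_right_injective₀ p_ne_zero)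
  have hm : MeasurableEmbedding (fun x : ℤ_[p] => (p : ℤ_[p]) * x) := hemb.measurableEmbedding
  -- The pullback of Haar measure along multiplication by `p` is again translation invariant, hence
  -- a multiple of it; the factor is the measure of `p ℤ_p`.
  set ν : Measure ℤ_[p] := (haarOne p).comap (fun x => (p : ℤ_[p]) * x) with hν
  have hνa : ∀ E, ν E = haarOne p ((fun x => (p : ℤ_[p]) * x) '' E) := fun E =>
    hm.comap_apply _ E
  have : ν.IsAddLeftInvariant := by
    refine ⟨fun g => ?_⟩
    ext E hE
    rw [Measure.map_apply (measurable_const_add g) hE, hνa, hνa,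
      ← measure_preimage_add (haarOne p) ((p : ℤ_[p]) * g) ((fun x => (p : ℤ_[p]) * x) '' E)]
    congr 1
    ext x
    constructor
    · rintro ⟨y, hy, rfl⟩
      exact ⟨g + y, hy, by ring⟩
    · rintro ⟨y, hy, hxy⟩
      refine ⟨y - g, by simpa using hy, ?_⟩
      simp only at hxy ⊢
      rw [mul_sub, hxy]; ring
  have hfin : IsFiniteMeasure ν := ⟨by rw [hνa]; exact measure_lt_top _ _⟩
  have h := Measure.addHaarMeasure_unique ν ⊤
  have huniv : ν.real Set.univ = (p : ℝ)⁻¹ := by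
    rw [measureReal_def, hνa, ← measureReal_def, ← pow_one (p : ℝ), ← haarOne_real_dvd (p := p) 1]
    congr 1
    ext x
    simp [dvd_def, eq_comm]
  have h2 : ν.real S = ν.real Set.univ * (haarOne p).real S := by
    rw [measureReal_def, measureReal_def, measureReal_def, ← ENNReal.toReal_mul]
    conv_lhs => rw [h]
    simp [haarOne]
  rw [measureReal_def, ← hνa, ← measureReal_def, h2, huniv]
  ring

end Haar

/-! ### Densities of the solutions of `x² ≡ d` modulo `p^j` -/

section Density

/-- The measure of `{x ∈ ℤ_p | x² ≡ d mod p^j}` for `d` of type `(∗, k)`. -/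
def sqDensity (p : ℕ) (star : Star) : ℕ → ℕ → ℝ
  | 0, 0 => 1
  | 0, j + 1 =>
    match star with
    | .square => 2 * ((p : ℝ) ^ (j + 1))⁻¹
    | .nonsquare => 0
  | 1, 0 => 1
  | 1, 1 => (p : ℝ)⁻¹
  | 1, _ + 2 => 0
  | _ + 2, 0 => 1
  | _ + 2, 1 => (p : ℝ)⁻¹
  | k + 2, j + 2 => sqDensity p star k j / p

variable {p : ℕ} [Fact p.Prime]

lemma p_dvd_of_dvd_sq_sub {x d : ℤ_[p]} {j : ℕ} (hj : j ≠ 0)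
    (h : (p : ℤ_[p]) ^ j ∣ x ^ 2 - d) (hd : (p : ℤ_[p]) ∣ d) : (p : ℤ_[p]) ∣ x :=
  PadicInt.prime_p.dvd_of_dvd_pow
    ((dvd_sub_left hd).1 ((dvd_pow_self _ hj).trans h))

lemma density_zero (d : ℤ_[p]) : (haarOne p).real {x : ℤ_[p] | (p : ℤ_[p]) ^ 0 ∣ x ^ 2 - d} = 1 := by
  simp

lemma density_one {d : ℤ_[p]} (hd : (p : ℤ_[p]) ∣ d) :
    (haarOne p).real {x : ℤ_[p] | (p : ℤ_[p]) ^ 1 ∣ x ^ 2 - d} = (p : ℝ)⁻¹ := by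
  rw [← pow_one (p : ℝ), ← haarOne_real_dvd (p := p) 1]
  congr 1
  ext x
  simp only [pow_one, Set.mem_ofPred_eq]
  exact ⟨fun h => p_dvd_of_dvd_sq_sub one_ne_zero (by rwa [pow_one]) hd,
    fun h => dvd_sub (dvd_pow h two_ne_zero) hd⟩

/-- The congruence forces `x = p y`, after which `p²` cancels; the substitution costs a factor `p`
in measure. -/
lemma density_add_two (d : ℤ_[p]) (j : ℕ) :
    (haarOne p).real {x : ℤ_[p] | (p : ℤ_[p]) ^ (j + 2) ∣ x ^ 2 - (p : ℤ_[p]) ^ 2 * d} =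
      (haarOne p).real {x : ℤ_[p] | (p : ℤ_[p]) ^ j ∣ x ^ 2 - d} / p := by
  rw [← haarOne_real_mul_p]
  congr 1
  have key : ∀ y : ℤ_[p], (p : ℤ_[p]) ^ (j + 2) ∣ (p * y) ^ 2 - (p : ℤ_[p]) ^ 2 * d ↔
      (p : ℤ_[p]) ^ j ∣ y ^ 2 - d := fun y => by
    rw [show (p * y) ^ 2 - (p : ℤ_[p]) ^ 2 * d = (p : ℤ_[p]) ^ 2 * (y ^ 2 - d) by ring, pow_add,
      mul_comm ((p : ℤ_[p]) ^ j), mul_dvd_mul_iff_left (pow_ne_zero _ p_ne_zero)]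
  ext x
  constructor
  · intro h
    obtain ⟨y, rfl⟩ := p_dvd_of_dvd_sq_sub (by omega) h
      (dvd_mul_of_dvd_left (dvd_pow_self _ two_ne_zero) _)
    exact ⟨y, (key y).1 h, rfl⟩
  · rintro ⟨y, hy, rfl⟩
    exact (key y).2 hy

/-- As `p` is odd, `x - u` and `x + u` cannot both be divisible by `p`, so one factor absorbs the
whole power and the solutions form two disjoint classes, around `u` and around `-u`. -/
lemma density_unit_square (hp : 3 ≤ p) {u : ℤ_[p]} (hu : IsUnit u) (j : ℕ) :
    (haarOne p).real {x : ℤ_[p] | (p : ℤ_[p]) ^ (j + 1) ∣ x ^ 2 - u ^ 2} =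
      2 * ((p : ℝ) ^ (j + 1))⁻¹ := by
  have hdisj : ∀ x : ℤ_[p], (p : ℤ_[p]) ∣ x - u → (p : ℤ_[p]) ∣ x - (-u) → False := by
    intro x h1 h2
    have h3 := dvd_sub h2 h1
    rw [show x - -u - (x - u) = 2 * u by ring] at h3
    exact isUnit_iff_not_p_dvd.1 ((isUnit_two hp).mul hu) h3
  have hpow : (p : ℤ_[p]) ∣ (p : ℤ_[p]) ^ (j + 1) := dvd_pow_self _ (by omega)
  have hset : {x : ℤ_[p] | (p : ℤ_[p]) ^ (j + 1) ∣ x ^ 2 - u ^ 2} =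
      {x : ℤ_[p] | (p : ℤ_[p]) ^ (j + 1) ∣ x - u} ∪
        {x : ℤ_[p] | (p : ℤ_[p]) ^ (j + 1) ∣ x - (-u)} := by
    ext x
    have hf : x ^ 2 - u ^ 2 = (x - u) * (x - -u) := by ring
    constructor
    · intro h
      rw [Set.mem_ofPred_eq, hf] at h
      by_cases h1 : (p : ℤ_[p]) ∣ x - u
      · exact Or.inl (((isUnit_iff_not_p_dvd.2 (hdisj x h1)).dvd_mul_right).1 h)
      · exact Or.inr (((isUnit_iff_not_p_dvd.2 h1).dvd_mul_left).1 h)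
    · rw [Set.mem_ofPred_eq, hf]
      rintro (h | h)
      · exact dvd_mul_of_dvd_left h _
      · exact dvd_mul_of_dvd_right h _
  rw [hset, measureReal_union _ (measurableSet_dvd_sub _ _), haarOne_real_dvd_sub,
    haarOne_real_dvd_sub, two_mul]
  exact Set.disjoint_left.2 fun x h1 h2 => hdisj x (hpow.trans h1) (hpow.trans h2)

lemma density_of_not_isSquare {ρ : ℤ_[p]} (hs : ¬ IsSquare (PadicInt.toZMod ρ)) (j : ℕ) :
    (haarOne p).real {x : ℤ_[p] | (p : ℤ_[p]) ^ (j + 1) ∣ x ^ 2 - ρ} = 0 := by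
  convert measureReal_empty
  ext x
  simp only [Set.mem_ofPred_eq, Set.mem_empty_iff_false, iff_false]
  intro h
  have h1 := (dvd_pow_self (p : ℤ_[p]) (by omega : j + 1 ≠ 0)).trans h
  rw [← toZMod_eq_zero_iff, map_sub, sub_eq_zero] at h1
  exact hs ⟨PadicInt.toZMod x, by rw [← h1, map_pow, sq]⟩

/-- A solution would be divisible by `p`, so its square by `p²`, whereas `p ρ` is divisible by `p`
only once. -/
lemma density_of_uniformizer {ρ : ℤ_[p]} (hρ : IsUnit ρ) (j : ℕ) :
    (haarOne p).real {x : ℤ_[p] | (p : ℤ_[p]) ^ (j + 2) ∣ x ^ 2 - p * ρ} = 0 := by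
  convert measureReal_empty
  ext x
  simp only [Set.mem_ofPred_eq, Set.mem_empty_iff_false, iff_false]
  intro h
  obtain ⟨y, rfl⟩ := p_dvd_of_dvd_sq_sub (by omega) h (dvd_mul_right _ _)
  have h1 := (pow_dvd_pow (p : ℤ_[p]) (by omega : 2 ≤ j + 2)).trans h
  rw [show (p * y) ^ 2 - p * ρ = p * (p * y ^ 2 - ρ) by ring, sq,
    mul_dvd_mul_iff_left p_ne_zero, dvd_sub_right (dvd_mul_right _ _)] at h1
  exact isUnit_iff_not_p_dvd.1 hρ h1

lemma HasType.of_add_two {d : ℤ_[p]} {star : Star} {k : ℕ} (h : HasType d star (k + 2)) :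
    ∃ d', d = (p : ℤ_[p]) ^ 2 * d' ∧ HasType d' star k := by
  cases star
  · obtain ⟨u, hu, rfl⟩ := h
    exact ⟨_, by rw [pow_add, mul_comm ((p : ℤ_[p]) ^ k), mul_assoc], u, hu, rfl⟩
  · obtain ⟨u, hu, hs, rfl⟩ := h
    exact ⟨_, by rw [pow_add, mul_comm ((p : ℤ_[p]) ^ k), mul_assoc], u, hu, hs, rfl⟩

lemma HasType.exists_of_one {d : ℤ_[p]} {star : Star} (h : HasType d star 1) :
    ∃ ρ, IsUnit ρ ∧ d = p * ρ := by
  cases star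
  · obtain ⟨u, hu, rfl⟩ := h
    exact ⟨_, hu.pow 2, by rw [pow_one]⟩
  · obtain ⟨u, hu, hs, rfl⟩ := h
    exact ⟨_, hu, by rw [pow_one]⟩

lemma HasType.density (hp : 3 ≤ p) {d : ℤ_[p]} {star : Star} {k : ℕ} (h : HasType d star k)
    (j : ℕ) : (haarOne p).real {x : ℤ_[p] | (p : ℤ_[p]) ^ j ∣ x ^ 2 - d} =
      sqDensity p star k j := by
  induction k using Nat.strong_induction_on generalizing d j with
  | _ k ih =>
    match k, j with
    | 0, 0 => rw [density_zero, sqDensity]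
    | 0, j + 1 =>
      cases star
      · obtain ⟨u, hu, rfl⟩ := h
        simp only [pow_zero, one_mul]
        rw [density_unit_square hp hu, sqDensity]
      · obtain ⟨u, hu, hs, rfl⟩ := h
        simp only [pow_zero, one_mul]
        rw [density_of_not_isSquare hs, sqDensity]
    | 1, 0 => rw [density_zero, sqDensity]
    | 1, 1 =>
      obtain ⟨ρ, hρ, rfl⟩ := h.exists_of_one
      rw [density_one (dvd_mul_right _ _), sqDensity]
    | 1, j + 2 =>
      obtain ⟨ρ, hρ, rfl⟩ := h.exists_of_one
      rw [density_of_uniformizer hρ, sqDensity]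
    | k + 2, 0 => rw [density_zero, sqDensity]
    | k + 2, 1 =>
      obtain ⟨d', rfl, h'⟩ := h.of_add_two
      rw [density_one (dvd_mul_of_dvd_left (dvd_pow_self _ two_ne_zero) _), sqDensity]
    | k + 2, j + 2 =>
      obtain ⟨d', rfl, h'⟩ := h.of_add_two
      rw [density_add_two, ih k (by omega) h', sqDensity]

end Density

/-! ### The generating series of the densities -/

section Series

variable {p : ℕ} [Fact p.Prime]

omit [Fact p.Prime] in
lemma sqDensity_zero_right (star : Star) (k : ℕ) : sqDensity p star k 0 = 1 := by
  match k with
  | 0 => rw [sqDensity]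
  | 1 => rw [sqDensity]
  | k + 2 => rw [sqDensity]

omit [Fact p.Prime] in
lemma sqDensity_nonneg (star : Star) (k j : ℕ) : 0 ≤ sqDensity p star k j := by
  induction k using Nat.strong_induction_on generalizing j with
  | _ k ih =>
    match k, j with
    | 0, 0 => rw [sqDensity]; positivity
    | 0, j + 1 => cases star <;> (simp only [sqDensity]; positivity)
    | 1, 0 => rw [sqDensity]; positivity
    | 1, 1 => rw [sqDensity]; positivity
    | 1, j + 2 => rw [sqDensity]
    | k + 2, 0 => rw [sqDensity]; positivity
    | k + 2, 1 => rw [sqDensity]; positivity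
    | k + 2, j + 2 =>
      rw [sqDensity]
      exact div_nonneg (ih k (by omega) j) (by positivity)

/-- The generating function of the densities, and its relation with `Z_{∗,k}`. -/
lemma exists_hasSum_sqDensity (star : Star) (k : ℕ) {s t : ℂ} (hts : (p : ℂ) ^ (-s) = t)
    (ht : ‖t‖ < p) :
    ∃ P : ℂ, HasSum (fun j => (sqDensity p star k j : ℂ) * t ^ j) P ∧
      t * (1 - (t / p) ^ 2) * explicitZ p star k s =
        (1 - (p : ℂ)⁻¹) * ((1 + t / p) - (1 - t) * P) := by
  have hp0 : (p : ℂ) ≠ 0 := Nat.cast_ne_zero.2 (NeZero.ne p)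
  have hx : ‖t / p‖ < 1 := by
    rw [norm_div, Complex.norm_natCast, div_lt_one (Nat.cast_pos.2 (NeZero.pos p))]
    exact ht
  have h1 : 1 - t / p ≠ 0 := by
    intro h
    rw [← sub_eq_zero.1 h] at hx
    simp at hx
  have h2 : 1 + t / p ≠ 0 := by
    intro h
    rw [show t / p = -1 by linear_combination h] at hx
    simp at hx
  have h1' : (p : ℂ) - t ≠ 0 := fun h => h1 (by field_simp; rw [h, mul_zero])
  have h2' : (p : ℂ) + t ≠ 0 := fun h => h2 (by field_simp; rw [h, mul_zero])
  have h3' : (p : ℂ) ^ 2 - t ^ 2 ≠ 0 := by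
    rw [sq_sub_sq]; exact mul_ne_zero h2' h1'
  induction k using Nat.strong_induction_on with
  | _ k ih =>
    match k with
    | 0 =>
      cases star
      -- The densities are `1` followed by `2 p^(-j)`, so the tail is geometric in `t / p`.
      · refine ⟨1 + 2 * (t / p) * (1 - t / p)⁻¹, ?_, ?_⟩
        · rw [← hasSum_nat_add_iff' 1]
          simp only [Finset.sum_range_one, sqDensity]
          have := (hasSum_geometric_of_norm_lt_one hx).mul_left (2 * (t / p))
          convert! this using 1
          · funext j
            push_cast
            rw [div_pow]
            field_simp
            try ring
          · simp; try ring
        · rw [explicitZ, hts]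
          field_simp
          ring
      · refine ⟨1, ?_, ?_⟩
        · convert hasSum_single 0 _ using 1
          · simp [sqDensity]
          · intro j hj
            obtain ⟨j, rfl⟩ := Nat.exists_eq_succ_of_ne_zero hj
            simp [sqDensity]
        · rw [explicitZ, hts]
          field_simp
          ring
    | 1 =>
      refine ⟨1 + t / p, ?_, ?_⟩
      · rw [← hasSum_nat_add_iff' 2]
        simp only [Finset.sum_range_succ, Finset.sum_range_zero, sqDensity]
        convert! hasSum_zero using 1
        · funext j; simp
        · simp; try ring
      · rw [explicitZ, hts]
        field_simp
        ring
    | k + 2 =>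
      obtain ⟨P, hP, hZ⟩ := ih k (by omega)
      -- The first two densities are `1` and `1/p`; the later ones are those for `k`, shifted by two
      -- places and divided by `p`.
      refine ⟨1 + t / p + t ^ 2 / p * P, ?_, ?_⟩
      · rw [← hasSum_nat_add_iff' 2]
        simp only [Finset.sum_range_succ, Finset.sum_range_zero, sqDensity]
        convert! hP.mul_left (t ^ 2 / p) using 1
        · funext j; push_cast; ring
        · simp; try ring
      · rw [explicitZ, hts]
        linear_combination ((p : ℂ)⁻¹ * t ^ 2) * hZ

end Series

/-! ### Integration over the shells of constant valuation -/

section Shells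

variable {p : ℕ} [Fact p.Prime]

lemma p_pow_dvd_iff {x : ℤ_[p]} (hx : x ≠ 0) {j : ℕ} :
    (p : ℤ_[p]) ^ j ∣ x ↔ j ≤ x.valuation := by
  rw [← Ideal.mem_span_singleton, PadicInt.mem_span_pow_iff_le_valuation x hx]

lemma measurableSet_dvd (l : ℕ) : MeasurableSet {x : ℤ_[p] | (p : ℤ_[p]) ^ l ∣ x} := by
  simpa using measurableSet_dvd_sub (p := p) l 0

lemma measurable_valuation : Measurable (PadicInt.valuation : ℤ_[p] → ℕ) := by
  refine measurable_of_Ici fun j => ?_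
  have : PadicInt.valuation ⁻¹' Set.Ici j =
      ({x : ℤ_[p] | (p : ℤ_[p]) ^ j ∣ x} \ {0}) ∪ {x | x = 0 ∧ j = 0} := by
    ext x
    by_cases hx : x = 0
    · simp [hx]
    · simp [hx, p_pow_dvd_iff hx]
  rw [this]
  refine ((measurableSet_dvd j).diff (measurableSet_singleton 0)).union ?_
  by_cases hj : j = 0 <;> simp [hj]

/-- Integration of a function of the valuation of `φ`, shell by shell. -/
lemma hasSum_integral_valuation {α E : Type*} [MeasurableSpace α] {μ : Measure α}
    [IsFiniteMeasure μ] [NormedAddCommGroup E] [NormedSpace ℝ E] [CompleteSpace E]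
    {φ : α → ℤ_[p]} (hφ : Measurable φ) (h0 : μ {x | φ x = 0} = 0) {M : ℕ → ℝ}
    (hM : ∀ j, μ.real {x | (p : ℤ_[p]) ^ j ∣ φ x} = M j) {c : ℕ → E}
    (hc : Summable fun j => (M j - M (j + 1)) * ‖c j‖) :
    Integrable (fun x => c (φ x).valuation) μ ∧
      HasSum (fun j => (M j - M (j + 1)) • c j) (∫ x, c (φ x).valuation ∂μ) := by
  have hv : Measurable (fun x => (φ x).valuation) := measurable_valuation.comp hφ
  have hshell : ∀ j, μ.real ((fun x => (φ x).valuation) ⁻¹' {j}) = M j - M (j + 1) := by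
    intro j
    have hsub : {x | (p : ℤ_[p]) ^ (j + 1) ∣ φ x} ⊆ {x | (p : ℤ_[p]) ^ j ∣ φ x} :=
      fun x hx => (pow_dvd_pow _ (Nat.le_succ j)).trans hx
    rw [← hM, ← hM, ← measureReal_sdiff hsub (hφ (measurableSet_dvd (j + 1)))]
    refine measureReal_congr ?_
    -- Zeros of `φ` have valuation 0 by convention although every power of `p` divides them; they
    -- must be null for the shells to have the stated measures.
    have hae : ∀ᵐ x ∂μ, φ x ≠ 0 := by rw [ae_iff]; simpa using h0
    filter_upwards [hae] with x hx
    refine propext ?_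
    change (φ x).valuation = j ↔ (p : ℤ_[p]) ^ j ∣ φ x ∧ ¬ (p : ℤ_[p]) ^ (j + 1) ∣ φ x
    rw [p_pow_dvd_iff hx, p_pow_dvd_iff hx]
    omega
  -- Pushed forward to `ℕ`, the measure is a sum of point masses, which turns the integral into a
  -- series.
  set ν : Measure ℕ := μ.map (fun x => (φ x).valuation) with hν
  have hνs : ∀ j, (ν {j}).toReal = M j - M (j + 1) := by
    intro j
    rw [← hshell, hν, Measure.map_apply hv (measurableSet_singleton j), measureReal_def]
  have hfin : ∀ j, ν {j} ≠ ⊤ := fun j => measure_ne_top _ _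
  have hsum : Summable fun j => (ν {j}).toReal * ‖c j‖ := by simpa only [hνs] using hc
  have hint : Integrable c ν := by
    rw [← Measure.sum_smul_dirac ν]
    exact integrable_sum_dirac hfin hsum
  refine ⟨hint.comp_measurable hv, ?_⟩
  rw [← integral_map (f := c) hv.aemeasurable hint.aestronglyMeasurable, ← hν]
  have := hasSum_integral_measure (f := c) (μ := fun j => ν {j} • Measure.dirac j)
    (by rw [Measure.sum_smul_dirac]; exact hint)
  rw [Measure.sum_smul_dirac] at this
  convert! this using 2 with j
  rw [integral_smul_measure, integral_dirac, hνs]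

end Shells

/-! ### The integral over `x` and its sum over the shells of `y` -/

section InnerIntegral

variable {p : ℕ} [Fact p.Prime]

lemma one_lt_p : (1 : ℝ) < p := Nat.one_lt_cast.2 (Fact.out : p.Prime).one_lt

lemma norm_p_cpow (s : ℂ) : ‖(p : ℂ) ^ s‖ = (p : ℝ) ^ s.re := by
  rw [Complex.norm_natCast_cpow_of_pos (NeZero.pos p)]

lemma norm_p_cpow_neg_lt {s : ℂ} (hs : -1 < s.re) : ‖(p : ℂ) ^ (-s)‖ < p := by
  rw [norm_p_cpow]
  conv_rhs => rw [← Real.rpow_one (p : ℝ)]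
  exact Real.rpow_lt_rpow_of_exponent_lt one_lt_p (by simp; linarith)

lemma p_cpow_ne_zero (s : ℂ) : (p : ℂ) ^ s ≠ 0 := by
  rw [← norm_ne_zero_iff, norm_p_cpow]
  exact (Real.rpow_pos_of_pos (by linarith [one_lt_p (p := p)]) _).ne'

/-- The sum `∑_j (ν_j - ν_{j+1}) t^j`, where `ν_j` are the densities of type `(∗, k)`; it is the
integral of `|x² - d|^s` over `ℤ_p`. -/
def sqZeta (p : ℕ) (star : Star) (k : ℕ) (t : ℂ) : ℂ :=
  ∑' j, ((sqDensity p star k j - sqDensity p star k (j + 1) : ℝ) : ℂ) * t ^ j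

/-- Shifting the index in `P = ∑ ν_j t^j` shows that the sum of differences is `P - (P - 1) / t`.
Substituting this into the relation between `P` and `Z_{∗,k}` eliminates `P`. -/
lemma hasSum_sqZeta (star : Star) (k : ℕ) {s t : ℂ} (hts : (p : ℂ) ^ (-s) = t) (ht : ‖t‖ < p) :
    HasSum (fun j => ((sqDensity p star k j - sqDensity p star k (j + 1) : ℝ) : ℂ) * t ^ j)
      (sqZeta p star k t) ∧
    (1 - (p : ℂ)⁻¹) * (sqZeta p star k t + (p : ℂ)⁻¹) =
      (1 - (t / p) ^ 2) * explicitZ p star k s := by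
  obtain ⟨P, hP, hZ⟩ := exists_hasSum_sqDensity star k hts ht
  have ht0 : t ≠ 0 := hts ▸ p_cpow_ne_zero _
  have h1 := (hasSum_nat_add_iff' 1).2 hP
  simp only [Finset.sum_range_one, sqDensity_zero_right, Complex.ofReal_one, pow_zero,
    mul_one] at h1
  have h2 : HasSum (fun j => ((sqDensity p star k j - sqDensity p star k (j + 1) : ℝ) : ℂ) * t ^ j)
      (P - (P - 1) / t) := by
    convert! hP.sub (h1.div_const t) using 2 with j
    push_cast
    rw [pow_succ]
    field_simp
  have h3 : sqZeta p star k t = P - (P - 1) / t := h2.tsum_eq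
  refine ⟨h3 ▸ h2, ?_⟩
  rw [h3]
  refine mul_left_cancel₀ ht0 ?_
  rw [← mul_assoc t (1 - (t / p) ^ 2), hZ]
  field_simp
  ring

lemma one_sub_p_inv_ne_zero : (1 - (p : ℂ)⁻¹) ≠ 0 := by
  intro h
  have h1 : (p : ℂ) = 1 := by
    have h2 : (p : ℂ)⁻¹ = 1 := (sub_eq_zero.1 h).symm
    rwa [inv_eq_one] at h2
  have := (Fact.out : p.Prime).one_lt
  norm_cast at h1
  omega

lemma sqZeta_add_two (star : Star) (k : ℕ) {s t : ℂ} (hts : (p : ℂ) ^ (-s) = t) (ht : ‖t‖ < p) :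
    sqZeta p star (k + 2) t = (1 - (p : ℂ)⁻¹) + t ^ 2 / p * sqZeta p star k t := by
  have h1 := (hasSum_sqZeta star k hts ht).2
  have h2 := (hasSum_sqZeta star (k + 2) hts ht).2
  rw [explicitZ, hts] at h2
  refine mul_left_cancel₀ (one_sub_p_inv_ne_zero (p := p)) ?_
  have hp0 : (p : ℂ) ≠ 0 := Nat.cast_ne_zero.2 (NeZero.ne p)
  linear_combination h2 - t ^ 2 / p * h1

/-- A solution of `u (m+1) = c + ρ u m` grows at most like `R^m` for any `R` above both `‖ρ‖` and 1.
The midpoint of `max ‖ρ‖ 1` and `P` is such an `R` and lies below `P`. -/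
lemma summable_of_affine_recursion {P : ℝ} (hP : 1 < P) {u : ℕ → ℂ} {c ρ : ℂ} (hρ : ‖ρ‖ < P)
    (hu : ∀ m, u (m + 1) = c + ρ * u m) : Summable fun m => (P ^ m)⁻¹ * ‖u m‖ := by
  set R : ℝ := (max ‖ρ‖ 1 + P) / 2 with hR
  have hRP : R < P := by
    have : max ‖ρ‖ 1 < P := max_lt hρ hP
    rw [hR]; linarith
  have hR1 : 1 ≤ R := by rw [hR]; linarith [le_max_right ‖ρ‖ 1]
  have hρR : ‖ρ‖ < R := by rw [hR]; linarith [le_max_left ‖ρ‖ 1]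
  set A : ℝ := max ‖u 0‖ (‖c‖ / (R - ‖ρ‖)) with hA
  have hA0 : 0 ≤ A := (norm_nonneg _).trans (le_max_left _ _)
  have hcA : ‖c‖ ≤ A * (R - ‖ρ‖) := by
    rw [← div_le_iff₀ (by linarith)]; exact le_max_right _ _
  have hb : ∀ m, ‖u m‖ ≤ A * R ^ m := by
    intro m
    induction m with
    | zero => rw [pow_zero, mul_one]; exact le_max_left _ _
    | succ m ih =>
      have hRm : 1 ≤ R ^ m := one_le_pow₀ hR1
      calc ‖u (m + 1)‖ ≤ ‖c‖ + ‖ρ‖ * ‖u m‖ := by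
            rw [hu, ← norm_mul]; exact norm_add_le _ _
        _ ≤ A * (R - ‖ρ‖) * R ^ m + ‖ρ‖ * (A * R ^ m) := by
            refine add_le_add (hcA.trans ?_) (by gcongr)
            exact le_mul_of_one_le_right (mul_nonneg hA0 (by linarith)) hRm
        _ = A * R ^ (m + 1) := by ring
  have hg : Summable fun m : ℕ => A * (R / P) ^ m :=
    (summable_geometric_of_lt_one (by positivity) ((div_lt_one (by linarith)).2 hRP)).mul_left A
  refine Summable.of_nonneg_of_le (fun m => by positivity) (fun m => ?_) hg
  rw [div_pow, inv_mul_eq_div, ← mul_div_assoc]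
  gcongr
  exact hb m

lemma norm_sq_div_p_lt {t : ℂ} (ht : ‖t‖ < p) : ‖t ^ 2 / p‖ < p := by
  have hp := one_lt_p (p := p)
  rw [norm_div, norm_pow, Complex.norm_natCast, div_lt_iff₀ (by linarith)]
  nlinarith [norm_nonneg t]

lemma summable_sqZeta_shift (star : Star) (k : ℕ) {s t : ℂ} (hts : (p : ℂ) ^ (-s) = t)
    (ht : ‖t‖ < p) : Summable fun m : ℕ => ((p : ℝ) ^ m)⁻¹ * ‖sqZeta p star (k + 2 * m) t‖ :=
  summable_of_affine_recursion one_lt_p (norm_sq_div_p_lt ht)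
    (u := fun m => sqZeta p star (k + 2 * m) t) fun m => sqZeta_add_two star (k + 2 * m) hts ht

/-- The recursion in `k` gives a linear equation for `S = ∑ p^(-m) sqZeta (k + 2m)`, namely `S -
sqZeta k = p⁻¹ (1 + t²/p S)`. Its solution is identified with `Z_{∗,k}` by `hasSum_sqZeta`; dividing
by `1 - (t/p)²` is allowed because `‖t‖ < p`. -/
lemma hasSum_sqZeta_shift (star : Star) (k : ℕ) {s t : ℂ} (hts : (p : ℂ) ^ (-s) = t)
    (ht : ‖t‖ < p) : HasSum (fun m : ℕ => (((p : ℝ) ^ m)⁻¹ - ((p : ℝ) ^ (m + 1))⁻¹ : ℝ) •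
      sqZeta p star (k + 2 * m) t) (explicitZ p star k s) := by
  have hp0 : (p : ℂ) ≠ 0 := Nat.cast_ne_zero.2 (NeZero.ne p)
  set c : ℂ := 1 - (p : ℂ)⁻¹ with hc
  have hS : Summable fun m : ℕ => ((p : ℂ)⁻¹) ^ m * sqZeta p star (k + 2 * m) t := by
    refine Summable.of_norm ((summable_sqZeta_shift star k hts ht).congr fun m => ?_)
    rw [norm_mul, norm_pow, norm_inv, Complex.norm_natCast, inv_pow]
  have hg : HasSum (fun m : ℕ => ((p : ℂ)⁻¹) ^ m) c⁻¹ := by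
    refine hasSum_geometric_of_norm_lt_one ?_
    rw [norm_inv, Complex.norm_natCast]
    exact inv_lt_one_of_one_lt₀ one_lt_p
  obtain ⟨S, hS⟩ := hS
  have h1 := (hasSum_nat_add_iff' 1).2 hS
  simp only [Finset.sum_range_one, pow_zero, one_mul, mul_zero, add_zero] at h1
  have h2 : HasSum (fun m : ℕ => ((p : ℂ)⁻¹) ^ (m + 1) * sqZeta p star (k + 2 * (m + 1)) t)
      ((p : ℂ)⁻¹ * (c * c⁻¹ + t ^ 2 / p * S)) := by
    convert! ((hg.mul_left c).add (hS.mul_left (t ^ 2 / p))).mul_left (p : ℂ)⁻¹ using 2 with m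
    rw [show k + 2 * (m + 1) = k + 2 * m + 2 by ring, sqZeta_add_two star _ hts ht]
    ring
  have h3 := h1.unique h2
  have h4 := (hasSum_sqZeta star k hts ht).2
  have hc0 : c ≠ 0 := one_sub_p_inv_ne_zero
  rw [mul_inv_cancel₀ hc0] at h3
  have h5 : (1 - (t / p) ^ 2) ≠ 0 := by
    intro h
    have h6 : ‖t / p‖ < 1 := by
      rw [norm_div, Complex.norm_natCast, div_lt_one (by linarith [one_lt_p (p := p)])]
      exact ht
    have h7 : ‖(t / p) ^ 2‖ = 1 := by rw [← sub_eq_zero.1 h]; simp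
    rw [norm_pow] at h7
    nlinarith [norm_nonneg (t / p)]
  have h6 : c * S = explicitZ p star k s := by
    refine mul_left_cancel₀ h5 ?_
    rw [← h4]
    linear_combination c * h3
  rw [← h6]
  convert! hS.mul_left c using 2 with m
  rw [Complex.real_smul, hc]
  push_cast
  rw [pow_succ, mul_inv, inv_pow]
  ring

end InnerIntegral

/-! ### Igusa's integral of `x² - d y²` -/

section Igusa

variable {p : ℕ} [Fact p.Prime]

lemma norm_cpow_eq {x : ℤ_[p]} (hx : x ≠ 0) (s : ℂ) :
    ((‖x‖ : ℝ) : ℂ) ^ s = ((p : ℂ) ^ (-s)) ^ x.valuation := by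
  rw [PadicInt.norm_eq_zpow_neg_valuation hx, zpow_neg, zpow_natCast, ← Complex.cpow_nat_mul]
  push_cast
  rw [mul_neg, Complex.cpow_neg, Complex.natCast_cpow_natCast_mul, Complex.inv_cpow]
  rw [← Nat.cast_pow, Complex.natCast_arg]
  exact Real.pi_pos.ne

lemma haarOne_sq_eq (d : ℤ_[p]) : haarOne p {x : ℤ_[p] | x ^ 2 - d = 0} = 0 := by
  by_cases h : ∃ r : ℤ_[p], r ^ 2 = d
  · obtain ⟨r, rfl⟩ := h
    refine measure_mono_null (t := {r, -r}) (fun x hx => ?_) ((Set.toFinite _).measure_zero _)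
    exact sq_eq_sq_iff_eq_or_eq_neg.1 (sub_eq_zero.1 hx)
  · rw [show {x : ℤ_[p] | x ^ 2 - d = 0} = ∅ from
      Set.eq_empty_of_forall_notMem fun x hx => h ⟨x, sub_eq_zero.1 hx⟩, measure_empty]

/-- Absolute convergence is convergence at the real exponent `s.re`, where `p^(-s)` becomes `‖t‖`.
-/
lemma summable_sqDensity_diff_norm (star : Star) (k : ℕ) {s t : ℂ} (hts : (p : ℂ) ^ (-s) = t)
    (ht : ‖t‖ < p) : Summable fun j =>
      (sqDensity p star k j - sqDensity p star k (j + 1)) * ‖t‖ ^ j := by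
  have h : (p : ℂ) ^ (-(s.re : ℂ)) = (‖t‖ : ℂ) := by
    rw [← hts, norm_p_cpow, Complex.ofReal_cpow (by positivity)]
    simp
  have := (hasSum_sqZeta star k h (by simpa using ht)).1.summable
  exact_mod_cast this

/-- The integral of `|x² - d|^s` over `ℤ_p`. -/
lemma HasType.hasSum_integral (hp : 3 ≤ p) {d : ℤ_[p]} {star : Star} {k : ℕ}
    (h : HasType d star k) {s t : ℂ} (hts : (p : ℂ) ^ (-s) = t) (ht : ‖t‖ < p) :
    Integrable (fun x : ℤ_[p] => ((‖x ^ 2 - d‖ : ℝ) : ℂ) ^ s) (haarOne p) ∧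
      ∫ x : ℤ_[p], ((‖x ^ 2 - d‖ : ℝ) : ℂ) ^ s ∂(haarOne p) = sqZeta p star k t ∧
      ((∫ x : ℤ_[p], ‖((‖x ^ 2 - d‖ : ℝ) : ℂ) ^ s‖ ∂(haarOne p) : ℝ) : ℂ) =
        sqZeta p star k (‖t‖ : ℂ) := by
  have hφ : Measurable fun x : ℤ_[p] => x ^ 2 - d := by fun_prop
  have hsum := summable_sqDensity_diff_norm star k hts ht
  obtain ⟨h1, h2⟩ := hasSum_integral_valuation hφ (haarOne_sq_eq d) (h.density hp)
    (c := fun j => t ^ j) (by simpa only [norm_pow] using hsum)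
  have hae : (fun x : ℤ_[p] => ((‖x ^ 2 - d‖ : ℝ) : ℂ) ^ s) =ᵐ[haarOne p]
      fun x => t ^ (x ^ 2 - d).valuation := by
    have : ∀ᵐ x ∂(haarOne p), x ^ 2 - d ≠ 0 := by
      rw [ae_iff]; simpa only [ne_eq, not_not] using haarOne_sq_eq d
    filter_upwards [this] with x hx
    rw [norm_cpow_eq hx, hts]
  -- The integral of the norm is needed as an explicit function of `k`, because Fubini requires it
  -- to be integrable in `y`.
  obtain ⟨-, h3⟩ := hasSum_integral_valuation hφ (haarOne_sq_eq d) (h.density hp)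
    (c := fun j => ‖t‖ ^ j) (by simpa only [norm_pow, norm_norm] using hsum)
  refine ⟨h1.congr hae.symm, ?_, ?_⟩
  · rw [integral_congr_ae hae, sqZeta, ← h2.tsum_eq]
    simp_rw [Complex.real_smul]
  · have : (fun x : ℤ_[p] => ‖((‖x ^ 2 - d‖ : ℝ) : ℂ) ^ s‖) =ᵐ[haarOne p]
        fun x => ‖t‖ ^ (x ^ 2 - d).valuation := by
      filter_upwards [hae] with x hx
      rw [hx, norm_pow]
    rw [integral_congr_ae this, sqZeta, ← h3.tsum_eq, Complex.ofReal_tsum]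
    congr 1
    funext j
    push_cast
    rw [smul_eq_mul]
    push_cast
    ring

/-- Igusa's integral of `x² - d y²`, over the product `ℤ_p × ℤ_p`. -/
lemma HasType.integral_prod (hp : 3 ≤ p) {d : ℤ_[p]} {star : Star} {k : ℕ}
    (h : HasType d star k) {s : ℂ} (hs : -1 < s.re) :
    Integrable (fun z : ℤ_[p] × ℤ_[p] => ((‖z.1 ^ 2 - d * z.2 ^ 2‖ : ℝ) : ℂ) ^ s)
      ((haarOne p).prod (haarOne p)) ∧
    ∫ z : ℤ_[p] × ℤ_[p], ((‖z.1 ^ 2 - d * z.2 ^ 2‖ : ℝ) : ℂ) ^ s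
      ∂((haarOne p).prod (haarOne p)) = explicitZ p star k s := by
  set t : ℂ := (p : ℂ) ^ (-s) with hts
  have ht : ‖t‖ < p := norm_p_cpow_neg_lt hs
  have htr : (p : ℂ) ^ (-(s.re : ℂ)) = (‖t‖ : ℂ) := by
    rw [hts, norm_p_cpow, Complex.ofReal_cpow (by positivity)]
    simp
  have htn : ‖(‖t‖ : ℂ)‖ < p := by simpa using ht
  have hmeas : Measurable (fun z : ℤ_[p] × ℤ_[p] => ((‖z.1 ^ 2 - d * z.2 ^ 2‖ : ℝ) : ℂ) ^ s) := by
    have : Measurable (fun z : ℤ_[p] × ℤ_[p] => ((‖z.1 ^ 2 - d * z.2 ^ 2‖ : ℝ) : ℂ)) :=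
      Continuous.measurable (by fun_prop)
    exact this.pow_const s
  have hne : ∀ᵐ y ∂(haarOne p), y ≠ 0 := by
    rw [ae_iff]; simp
  -- For fixed `y ≠ 0` the inner integrand belongs to `d y²`, of type `(∗, k + 2 v(y))`, so both
  -- inner integrals are functions of the valuation of `y`.
  have key : ∀ y : ℤ_[p], y ≠ 0 → _ := fun y hy => (h.mul_sq hy).hasSum_integral hp hts.symm ht
  have h0 : haarOne p {y : ℤ_[p] | id y = 0} = 0 := by
    simp
  have hshift : ∀ {E : Type} [NormedAddCommGroup E] (c : ℕ → E),
      (Summable fun m => ((p : ℝ) ^ m)⁻¹ * ‖c m‖) →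
      Summable fun m => (((p : ℝ) ^ m)⁻¹ - ((p : ℝ) ^ (m + 1))⁻¹) * ‖c m‖ := by
    intro E _ c hc
    refine (hc.mul_left (1 - (p : ℝ)⁻¹)).congr fun m => ?_
    rw [pow_succ, mul_inv]; ring
  obtain ⟨i1, s1⟩ := hasSum_integral_valuation (p := p) (φ := id) measurable_id h0
    (M := fun m => ((p : ℝ) ^ m)⁻¹) (fun m => haarOne_real_dvd m)
    (c := fun m => sqZeta p star (k + 2 * m) t)
    (hshift _ (summable_sqZeta_shift star k hts.symm ht))
  -- Same summation at the real argument `‖t‖`: it yields integrability over `y` of the inner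
  -- integrals of norms.
  obtain ⟨i2, -⟩ := hasSum_integral_valuation (p := p) (φ := id) measurable_id h0
    (M := fun m => ((p : ℝ) ^ m)⁻¹) (fun m => haarOne_real_dvd m)
    (c := fun m => sqZeta p star (k + 2 * m) (‖t‖ : ℂ))
    (hshift _ (summable_sqZeta_shift star k htr htn))
  have hint : Integrable (fun z : ℤ_[p] × ℤ_[p] => ((‖z.1 ^ 2 - d * z.2 ^ 2‖ : ℝ) : ℂ) ^ s)
      ((haarOne p).prod (haarOne p)) := by
    rw [integrable_prod_iff' hmeas.aestronglyMeasurable]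
    constructor
    · filter_upwards [hne] with y hy
      exact (key y hy).1
    · refine i2.re.congr ?_
      filter_upwards [hne] with y hy
      rw [id, ← (key y hy).2.2]
      exact Complex.ofReal_re _
  refine ⟨hint, ?_⟩
  rw [integral_prod_symm _ hint, (hasSum_sqZeta_shift star k hts.symm ht).unique s1]
  refine integral_congr_ae ?_
  filter_upwards [hne] with y hy
  exact (key y hy).2.1

lemma HasType.igusa (hp : 3 ≤ p) {d : ℤ_[p]} {star : Star} {k : ℕ}
    (h : HasType d star k) {s : ℂ} (hs : -1 < s.re) :
    Integrable (igusaIntegrand (binaryForm d) s) (haarPow p 2) ∧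
      igusaZeta (binaryForm d) s = explicitZ p star k s := by
  obtain ⟨h1, h2⟩ := h.integral_prod hp hs
  have hmp : MeasurePreserving (MeasurableEquiv.finTwoArrow (α := ℤ_[p])) (haarPow p 2)
      ((haarOne p).prod (haarOne p)) := measurePreserving_finTwoArrow (haarOne p)
  have he : igusaIntegrand (binaryForm d) s =
      (fun z : ℤ_[p] × ℤ_[p] => ((‖z.1 ^ 2 - d * z.2 ^ 2‖ : ℝ) : ℂ) ^ s) ∘
        MeasurableEquiv.finTwoArrow := by
    funext x
    simp [igusaIntegrand, binaryForm]
  constructor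
  · rw [he]
    exact (hmp.integrable_comp_emb (MeasurableEquiv.measurableEmbedding _)).2 h1
  · rw [igusaZeta, he, ← h2]
    exact hmp.integral_comp (MeasurableEquiv.measurableEmbedding _)
      (fun z : ℤ_[p] × ℤ_[p] => ((‖z.1 ^ 2 - d * z.2 ^ 2‖ : ℝ) : ℂ) ^ s)

end Igusa

/-! ### Normal form of the Lie algebra and its quadratic form -/

section NormalForm

variable {p : ℕ} [Fact p.Prime] {L : Type*} [LieRing L] [LieAlgebra ℤ_[p] L]

/-- The basis `e` brings `L` into the form `[e₀,e₁] = a e₁ - q d e₂`, `[e₀,e₂] = a e₂ - q e₁`,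
`[e₁,e₂] = 0`. -/
structure IsNormalBasis (e : Module.Basis (Fin 3) ℤ_[p] L) (a q d : ℤ_[p]) : Prop where
  bracket01 : ⁅e 0, e 1⁆ = a • e 1 - (q * d) • e 2
  bracket02 : ⁅e 0, e 2⁆ = a • e 2 - q • e 1
  bracket12 : ⁅e 1, e 2⁆ = 0

/-- The two contributions of the scalar `a`, namely `-a x₃ x₂` and `a x₂ x₃`, cancel. -/
lemma IsNormalBasis.ternaryForm_eq {e : Module.Basis (Fin 3) ℤ_[p] L} {a q d : ℤ_[p]}
    (h : IsNormalBasis e a q d) : ternaryForm e = MvPolynomial.C q *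
      (MvPolynomial.X 1 ^ 2 - MvPolynomial.C d * MvPolynomial.X 2 ^ 2) := by
  simp only [ternaryForm, structForm, h.bracket01, h.bracket02, h.bracket12, Fin.sum_univ_three,
    map_sub, map_smul, map_zero, Module.Basis.repr_self, Finsupp.coe_zero, Pi.zero_apply,
    Finsupp.coe_sub, Finsupp.coe_smul, Pi.sub_apply, Pi.smul_apply, smul_eq_mul,
    Finsupp.single_apply]
  simp only [map_zero, zero_mul, Fin.isValue, Fin.reduceEq, if_true, if_false, mul_one, mul_zero,
    map_mul]
  ring

lemma exists_shear_basis (e : Module.Basis (Fin 3) ℤ_[p] L) (c : ℤ_[p]) :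
    ∃ e' : Module.Basis (Fin 3) ℤ_[p] L, e' 0 = e 0 ∧ e' 1 = e 1 + c • e 2 ∧ e' 2 = e 2 := by
  let f : ℤ_[p] → L →ₗ[ℤ_[p]] L := fun c => e.constr ℤ_[p] ![e 0, e 1 + c • e 2, e 2]
  have hf0 : ∀ c, f c (e 0) = e 0 := fun c => by simp [f]
  have hf1 : ∀ c, f c (e 1) = e 1 + c • e 2 := fun c => by simp [f]
  have hf2 : ∀ c, f c (e 2) = e 2 := fun c => by simp [f]
  have hinv : ∀ c, f c ∘ₗ f (-c) = LinearMap.id := fun c => by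
    refine e.ext fun i => ?_
    fin_cases i
    · simp [hf0]
    · simp [hf1, hf2]
    · simp [hf2]
  let T : L ≃ₗ[ℤ_[p]] L := LinearEquiv.ofLinearMap (f c) (f (-c)) (hinv c) (by
    simpa using hinv (-c))
  exact ⟨e.map T, by simp [T, hf0], by simp [T, hf1], by simp [T, hf2]⟩

/-- In family D the diagonal of the matrix is the scalar part and `ι = i + r`. In family E the shear
by `c = p^r / 2` completes the square, replacing `d` by `d + c²`, and `4 (d + c²) = p^(2r) + 4d` is
nonzero by hypothesis. Families F and G are already normal, with `a = 0`. -/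
lemma SolubleFamily.IsMember.exists_normalBasis (hp : 3 ≤ p) {φ : SolubleFamily p}
    (hφ : φ.Nondegenerate) {i : ℕ} (hL : φ.IsMember i L) :
    ∃ (e : Module.Basis (Fin 3) ℤ_[p] L) (a d : ℤ_[p]) (star : Star) (k ι : ℕ),
      HasType d star k ∧ IsNormalBasis e a ((p : ℤ_[p]) ^ ι) d := by
  obtain ⟨e, h01, h02, h12⟩ := hL
  cases φ with
  | famD r hr d =>
    obtain ⟨star, k, hd⟩ := exists_hasType hp (d := d) hφ
    refine ⟨e, -(p : ℤ_[p]) ^ i, d, star, k, i + r, hd, ⟨?_, ?_, h12⟩⟩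
    · rw [h01]
      simp only [relMatrix, Matrix.of_apply, Matrix.cons_val', Matrix.cons_val_zero,
        Matrix.cons_val_one, Matrix.cons_val_fin_one]
      module
    · rw [h02]
      simp only [relMatrix, Matrix.of_apply, Matrix.cons_val', Matrix.cons_val_zero,
        Matrix.cons_val_one, Matrix.cons_val_fin_one]
      module
  | famE r d =>
    obtain ⟨h, hh⟩ := (isUnit_two hp).exists_right_inv
    set c : ℤ_[p] := h * (p : ℤ_[p]) ^ r with hc
    have hpr : (p : ℤ_[p]) ^ r = 2 * c := by rw [hc]; linear_combination -(p : ℤ_[p]) ^ r * hh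
    have hD : d + c ^ 2 ≠ 0 := by
      intro h0
      apply hφ
      rw [pow_mul', hpr]
      linear_combination 4 * h0
    obtain ⟨star, k, hd⟩ := exists_hasType hp hD
    obtain ⟨e', h0, h1, h2⟩ := exists_shear_basis e c
    refine ⟨e', -(p : ℤ_[p]) ^ i * c, d + c ^ 2, star, k, i, hd, ⟨?_, ?_, ?_⟩⟩
    · rw [h0, h1, h2, lie_add, lie_smul, h01, h02]
      simp only [relMatrix, Matrix.of_apply, Matrix.cons_val', Matrix.cons_val_zero,
        Matrix.cons_val_one, Matrix.cons_val_fin_one, hpr]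
      module
    · rw [h0, h1, h2, h02]
      simp only [relMatrix, Matrix.of_apply, Matrix.cons_val', Matrix.cons_val_zero,
        Matrix.cons_val_one, Matrix.cons_val_fin_one, hpr]
      module
    · rw [h1, h2, add_lie, smul_lie, lie_self, h12]
      simp
  | famF r =>
    refine ⟨e, 0, (p : ℤ_[p]) ^ r, .square, r, i, ⟨1, isUnit_one, by simp⟩, ⟨?_, ?_, h12⟩⟩
    · rw [h01]
      simp only [relMatrix, Matrix.of_apply, Matrix.cons_val', Matrix.cons_val_zero,
        Matrix.cons_val_one, Matrix.cons_val_fin_one]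
      module
    · rw [h02]
      simp only [relMatrix, Matrix.of_apply, Matrix.cons_val', Matrix.cons_val_zero,
        Matrix.cons_val_one, Matrix.cons_val_fin_one]
      module
  | famG r ρ hunit hns =>
    refine ⟨e, 0, (p : ℤ_[p]) ^ r * ρ, .nonsquare, r, i, ⟨ρ, hunit, hns, rfl⟩, ⟨?_, ?_, h12⟩⟩
    · rw [h01]
      simp only [relMatrix, Matrix.of_apply, Matrix.cons_val', Matrix.cons_val_zero,
        Matrix.cons_val_one, Matrix.cons_val_fin_one]
      module
    · rw [h02]
      simp only [relMatrix, Matrix.of_apply, Matrix.cons_val', Matrix.cons_val_zero,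
        Matrix.cons_val_one, Matrix.cons_val_fin_one]
      module

end NormalForm

/-! ### Indices and ideals of `ℤ_[p]` -/

section Index

/-- The index of a submodule is the product of the indices of its image and of its kernel part
in a short exact sequence. -/
lemma index_eq_map_mul_comap {R M N K : Type*} [Ring R] [AddCommGroup M] [AddCommGroup N]
    [AddCommGroup K] [Module R M] [Module R N] [Module R K] {f : M →ₗ[R] N} {g : K →ₗ[R] M}
    (hf : Function.Surjective f) (hfg : LinearMap.range g = LinearMap.ker f)
    (H : Submodule R M) :
    H.toAddSubgroup.index =
      (H.map f).toAddSubgroup.index * (H.comap g).toAddSubgroup.index := by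
  have h1 : (H.map f).toAddSubgroup = H.toAddSubgroup.map f.toAddMonoidHom := rfl
  have h2 : (H.comap g).toAddSubgroup = H.toAddSubgroup.comap g.toAddMonoidHom := rfl
  have hr : f.toAddMonoidHom.range = ⊤ := AddMonoidHom.range_eq_top.2 hf
  have hk : g.toAddMonoidHom.range = f.toAddMonoidHom.ker := by
    ext x
    have := SetLike.ext_iff.1 hfg x
    simpa using this
  rw [h1, h2, AddSubgroup.index_map, hr, AddSubgroup.index_top, mul_one, AddSubgroup.index_comap,
    hk, ← AddSubgroup.relIndex_sup_left, mul_comm,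
    sup_comm H.toAddSubgroup, AddSubgroup.relIndex_mul_index le_sup_right]

variable {p : ℕ} [Fact p.Prime]

lemma index_span_p_pow (n : ℕ) :
    (Ideal.span {(p : ℤ_[p]) ^ n}).toAddSubgroup.index = p ^ n := by
  have : (Ideal.span {(p : ℤ_[p]) ^ n}).toAddSubgroup =
      (PadicInt.toZModPow n : ℤ_[p] →+* ZMod (p ^ n)).toAddMonoidHom.ker := by
    ext x
    rw [← PadicInt.ker_toZModPow]
    rfl
  rw [this, AddSubgroup.index_ker, AddMonoidHom.range_eq_top.2 (toZModPow_surjective n)]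
  simp

lemma exists_eq_span_of_index_ne_zero {I : Submodule ℤ_[p] ℤ_[p]}
    (h : I.toAddSubgroup.index ≠ 0) : ∃ n : ℕ, I = Ideal.span {(p : ℤ_[p]) ^ n} := by
  refine PadicInt.ideal_eq_span_pow_p fun h0 => h ?_
  rw [h0]
  change (⊥ : AddSubgroup ℤ_[p]).index = 0
  rw [AddSubgroup.index_bot]
  have : Infinite ℤ_[p] := CharZero.infinite _
  exact Nat.card_eq_zero_of_infinite

lemma mem_span_p_pow {n : ℕ} {x : ℤ_[p]} :
    x ∈ Ideal.span {(p : ℤ_[p]) ^ n} ↔ (p : ℤ_[p]) ^ n ∣ x := Ideal.mem_span_singleton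

lemma span_p_pow_le_iff {m n : ℕ} :
    (Ideal.span {(p : ℤ_[p]) ^ m} : Ideal ℤ_[p]) ≤ Ideal.span {(p : ℤ_[p]) ^ n} ↔ n ≤ m := by
  rw [Ideal.span_singleton_le_span_singleton,
    pow_dvd_pow_iff p_ne_zero PadicInt.prime_p.not_isUnit]

lemma span_p_pow_injective {m n : ℕ}
    (h : Ideal.span {(p : ℤ_[p]) ^ m} = Ideal.span {(p : ℤ_[p]) ^ n}) : m = n :=
  le_antisymm (span_p_pow_le_iff.1 h.ge) (span_p_pow_le_iff.1 h.le)

end Index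

/-! ### Classification of the sublattices of finite index in `ℤ_p²` -/

section Lattices

/-- The points of the projective line over `ℤ/p^l`: the points `[1 : x]`, and the points `[y : 1]`
with `y` not a unit. -/
abbrev ProjPoint (p l : ℕ) : Type := ZMod (p ^ l) ⊕ {y : ZMod (p ^ l) // ¬ IsUnit y}

variable {p : ℕ} [Fact p.Prime]

/-- The sublattice of `ℤ_p²` of index `p^l` given by a point of the projective line. -/
def primLattice (l : ℕ) : ProjPoint p l → Submodule ℤ_[p] (ℤ_[p] × ℤ_[p])
  | .inl x =>
    { carrier := {u | PadicInt.toZModPow l u.2 = x * PadicInt.toZModPow l u.1}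
      add_mem' := fun {u v} hu hv => by
        simp only [Set.mem_ofPred_eq, Prod.snd_add, Prod.fst_add, map_add] at *
        rw [hu, hv]; ring
      zero_mem' := by simp
      smul_mem' := fun c u hu => by
        simp only [Set.mem_ofPred_eq, Prod.smul_snd, Prod.smul_fst, smul_eq_mul, map_mul] at *
        rw [hu]; ring }
  | .inr y =>
    { carrier := {u | PadicInt.toZModPow l u.1 = y.1 * PadicInt.toZModPow l u.2}
      add_mem' := fun {u v} hu hv => by
        simp only [Set.mem_ofPred_eq, Prod.snd_add, Prod.fst_add, map_add] at *
        rw [hu, hv]; ring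
      zero_mem' := by simp
      smul_mem' := fun c u hu => by
        simp only [Set.mem_ofPred_eq, Prod.smul_snd, Prod.smul_fst, smul_eq_mul, map_mul] at *
        rw [hu]; ring }

lemma mem_primLattice_inl {l : ℕ} {x : ZMod (p ^ l)} {u : ℤ_[p] × ℤ_[p]} :
    u ∈ primLattice l (.inl x) ↔ PadicInt.toZModPow l u.2 = x * PadicInt.toZModPow l u.1 :=
  Iff.rfl

lemma mem_primLattice_inr {l : ℕ} {y : {y : ZMod (p ^ l) // ¬ IsUnit y}} {u : ℤ_[p] × ℤ_[p]} :
    u ∈ primLattice l (.inr y) ↔ PadicInt.toZModPow l u.1 = y.1 * PadicInt.toZModPow l u.2 :=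
  Iff.rfl

/-- The sublattice `p^m Λ` of `ℤ_p²`, where `Λ` is given by a point of the projective line. -/
def lattice (m l : ℕ) (x : ProjPoint p l) : Submodule ℤ_[p] (ℤ_[p] × ℤ_[p]) :=
  (primLattice l x).map (LinearMap.lsmul ℤ_[p] (ℤ_[p] × ℤ_[p]) ((p : ℤ_[p]) ^ m))

lemma mem_lattice {m l : ℕ} {x : ProjPoint p l} {u : ℤ_[p] × ℤ_[p]} :
    u ∈ lattice m l x ↔ ∃ w ∈ primLattice l x, (p : ℤ_[p]) ^ m • w = u := by
  simp [lattice, Submodule.mem_map]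

lemma smul_mem_lattice {m l : ℕ} {x : ProjPoint p l} {w : ℤ_[p] × ℤ_[p]} :
    (p : ℤ_[p]) ^ m • w ∈ lattice m l x ↔ w ∈ primLattice l x := by
  rw [mem_lattice]
  refine ⟨?_, fun h => ⟨w, h, rfl⟩⟩
  rintro ⟨w', h, h'⟩
  rwa [← smul_right_injective _ (pow_ne_zero m p_ne_zero) h']

lemma mem_primLattice_inl_iff_dvd {l : ℕ} {x : ℤ_[p]} {u : ℤ_[p] × ℤ_[p]} :
    u ∈ primLattice l (.inl (PadicInt.toZModPow l x)) ↔ (p : ℤ_[p]) ^ l ∣ u.2 - x * u.1 := by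
  rw [mem_primLattice_inl, ← map_mul, toZModPow_eq_iff]

lemma mem_primLattice_inr_iff_dvd {l : ℕ} {y : ℤ_[p]} (hy : ¬ IsUnit (PadicInt.toZModPow l y))
    {u : ℤ_[p] × ℤ_[p]} :
    u ∈ primLattice l (.inr ⟨PadicInt.toZModPow l y, hy⟩) ↔
      (p : ℤ_[p]) ^ l ∣ u.1 - y * u.2 := by
  rw [mem_primLattice_inr, ← map_mul, toZModPow_eq_iff]

lemma exists_lift_inr {l : ℕ} (y : {y : ZMod (p ^ l) // ¬ IsUnit y}) :
    ∃ (z : ℤ_[p]) (hz : ¬ IsUnit (PadicInt.toZModPow l z)), y = ⟨PadicInt.toZModPow l z, hz⟩ := by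
  obtain ⟨y, hy⟩ := y
  obtain ⟨z, rfl⟩ := toZModPow_surjective l y
  exact ⟨z, hy, rfl⟩

lemma p_dvd_of_not_isUnit {l : ℕ} {z : ℤ_[p]} (hz : ¬ IsUnit (PadicInt.toZModPow l z)) :
    (p : ℤ_[p]) ∣ z := by
  by_contra h
  exact hz ((isUnit_iff_not_p_dvd.2 h).map _)

lemma not_isUnit_toZModPow {l : ℕ} (hl : l ≠ 0) {z : ℤ_[p]} (hz : (p : ℤ_[p]) ∣ z) :
    ¬ IsUnit (PadicInt.toZModPow l z) := by
  intro h
  obtain ⟨w, hw⟩ := h.exists_right_inv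
  obtain ⟨w, rfl⟩ := toZModPow_surjective l w
  rw [← map_mul, ← map_one (PadicInt.toZModPow l), toZModPow_eq_iff] at hw
  have h1 := (dvd_pow_self _ hl).trans hw
  rw [dvd_sub_right (dvd_mul_of_dvd_left hz _)] at h1
  exact PadicInt.prime_p.not_dvd_one h1

lemma index_lattice (m l : ℕ) (x : ProjPoint p l) :
    (lattice m l x).toAddSubgroup.index = p ^ (2 * m + l) := by
  have hp0 : (p : ℤ_[p]) ^ m ≠ 0 := pow_ne_zero _ p_ne_zero
  cases x with
  | inl x =>
    obtain ⟨x, rfl⟩ := toZModPow_surjective l x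
    have h1 : (lattice m l (.inl (PadicInt.toZModPow l x))).map
        (LinearMap.fst ℤ_[p] ℤ_[p] ℤ_[p]) = Ideal.span {(p : ℤ_[p]) ^ m} := by
      ext a
      simp only [Submodule.mem_map, mem_lattice, mem_primLattice_inl_iff_dvd, mem_span_p_pow]
      constructor
      · rintro ⟨u, ⟨w, hw, rfl⟩, rfl⟩
        exact dvd_mul_right _ _
      · rintro ⟨b, rfl⟩
        exact ⟨_, ⟨(b, x * b), by simp, rfl⟩, rfl⟩
    have h2 : (lattice m l (.inl (PadicInt.toZModPow l x))).comap
        (LinearMap.inr ℤ_[p] ℤ_[p] ℤ_[p]) = Ideal.span {(p : ℤ_[p]) ^ (m + l)} := by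
      ext b
      simp only [Submodule.mem_comap, mem_lattice, mem_primLattice_inl_iff_dvd,
        LinearMap.inr_apply, Prod.ext_iff, Prod.smul_fst, Prod.smul_snd, smul_eq_mul, mul_eq_zero,
        hp0, false_or]
      rw [mem_span_p_pow, pow_add]
      constructor
      · rintro ⟨w, hw, h0, rfl⟩
        rw [h0, mul_zero, sub_zero] at hw
        exact mul_dvd_mul_left _ hw
      · rintro ⟨c, rfl⟩
        exact ⟨(0, (p : ℤ_[p]) ^ l * c), by simp, rfl, by ring⟩
    rw [index_eq_map_mul_comap LinearMap.fst_surjective (LinearMap.range_inr _ _ _), h1, h2,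
      index_span_p_pow, index_span_p_pow, ← pow_add]
    congr 1; ring
  | inr y =>
    obtain ⟨y, hy, rfl⟩ := exists_lift_inr y
    have h1 : (lattice m l (.inr ⟨PadicInt.toZModPow l y, hy⟩)).map
        (LinearMap.snd ℤ_[p] ℤ_[p] ℤ_[p]) = Ideal.span {(p : ℤ_[p]) ^ m} := by
      ext a
      simp only [Submodule.mem_map, mem_lattice, mem_primLattice_inr_iff_dvd, mem_span_p_pow]
      constructor
      · rintro ⟨u, ⟨w, hw, rfl⟩, rfl⟩
        exact dvd_mul_right _ _
      · rintro ⟨b, rfl⟩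
        exact ⟨_, ⟨(y * b, b), by simp, rfl⟩, rfl⟩
    have h2 : (lattice m l (.inr ⟨PadicInt.toZModPow l y, hy⟩)).comap
        (LinearMap.inl ℤ_[p] ℤ_[p] ℤ_[p]) = Ideal.span {(p : ℤ_[p]) ^ (m + l)} := by
      ext b
      simp only [Submodule.mem_comap, mem_lattice, mem_primLattice_inr_iff_dvd,
        LinearMap.inl_apply, Prod.ext_iff, Prod.smul_fst, Prod.smul_snd, smul_eq_mul, mul_eq_zero,
        hp0, false_or]
      rw [mem_span_p_pow, pow_add]
      constructor
      · rintro ⟨w, hw, rfl, h0⟩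
        rw [h0, mul_zero, sub_zero] at hw
        exact mul_dvd_mul_left _ hw
      · rintro ⟨c, rfl⟩
        exact ⟨((p : ℤ_[p]) ^ l * c, 0), by simp, by ring, rfl⟩
    rw [index_eq_map_mul_comap LinearMap.snd_surjective
      (LinearMap.range_inl _ _ _), h1, h2, index_span_p_pow, index_span_p_pow, ← pow_add]
    congr 1; ring

lemma exists_mem_primLattice_not_dvd {l : ℕ} (x : ProjPoint p l) :
    ∃ w ∈ primLattice l x, ¬ ((p : ℤ_[p]) ∣ w.1 ∧ (p : ℤ_[p]) ∣ w.2) := by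
  cases x with
  | inl x =>
    obtain ⟨x, rfl⟩ := toZModPow_surjective l x
    exact ⟨(1, x), by simp [mem_primLattice_inl], fun h => PadicInt.prime_p.not_dvd_one h.1⟩
  | inr y =>
    obtain ⟨y, hy, rfl⟩ := exists_lift_inr y
    exact ⟨(y, 1), by simp [mem_primLattice_inr], fun h => PadicInt.prime_p.not_dvd_one h.2⟩

/-- A lattice given by a projective point contains a vector not divisible by `p`, so `p^m` is the
exact common divisor of `p^m Λ`; this makes `m` an invariant. -/
lemma le_of_lattice_le {m l m' l' : ℕ} {x : ProjPoint p l} {x' : ProjPoint p l'}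
    (h : lattice m l x ≤ lattice m' l' x') : m' ≤ m := by
  obtain ⟨w, hw, hnd⟩ := exists_mem_primLattice_not_dvd x
  obtain ⟨w', hw', he⟩ := mem_lattice.1 (h (smul_mem_lattice.2 hw))
  by_contra hlt
  obtain ⟨c, rfl⟩ := Nat.exists_eq_add_of_lt (not_le.1 hlt)
  have hw2 : (p : ℤ_[p]) ^ (c + 1) • w' = w := by
    refine smul_right_injective _ (pow_ne_zero m (p_ne_zero (p := p))) ?_
    change (p : ℤ_[p]) ^ m • (p : ℤ_[p]) ^ (c + 1) • w' = (p : ℤ_[p]) ^ m • w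
    rw [smul_smul, ← pow_add, ← he, add_assoc]
  apply hnd
  rw [← hw2]
  exact ⟨dvd_mul_of_dvd_left (dvd_pow_self _ (by omega)) _,
    dvd_mul_of_dvd_left (dvd_pow_self _ (by omega)) _⟩

lemma primLattice_injective (l : ℕ) : Function.Injective (primLattice l (p := p)) := by
  intro x x' h
  cases x with
  | inl x =>
    obtain ⟨x, rfl⟩ := toZModPow_surjective l x
    have h1 : ((1 : ℤ_[p]), x) ∈ primLattice l x' := by
      rw [← h]; simp [mem_primLattice_inl]
    cases x' with
    | inl x' => simpa [mem_primLattice_inl] using h1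
    | inr y' =>
      have h2 := mem_primLattice_inr.1 h1
      exact absurd (IsUnit.of_mul_eq_one _ (by rw [← h2, map_one])) y'.2
  | inr y =>
    obtain ⟨y, hy, rfl⟩ := exists_lift_inr y
    have h1 : (y, (1 : ℤ_[p])) ∈ primLattice l x' := by
      rw [← h]; simp [mem_primLattice_inr]
    cases x' with
    | inl x' =>
      have h2 := mem_primLattice_inl.1 h1
      exact absurd (IsUnit.of_mul_eq_one_right _ (by rw [← h2, map_one])) hy
    | inr y' =>
      have h2 := mem_primLattice_inr.1 h1
      simp only [map_one, mul_one] at h2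
      exact congrArg _ (Subtype.ext h2)

/-- The data describing a sublattice of finite index of `ℤ_p²`. -/
abbrev LatticeData (p : ℕ) : Type := ℕ × Σ l : ℕ, ProjPoint p l

/-- The lattice described by the data. -/
def latticeOf (c : LatticeData p) : Submodule ℤ_[p] (ℤ_[p] × ℤ_[p]) := lattice c.1 c.2.1 c.2.2

lemma index_latticeOf (c : LatticeData p) :
    (latticeOf c).toAddSubgroup.index = p ^ (2 * c.1 + c.2.1) := index_lattice _ _ _

lemma latticeOf_injective : Function.Injective (latticeOf (p := p)) := by
  rintro ⟨m, l, x⟩ ⟨m', l', x'⟩ h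
  have hm : m = m' := le_antisymm (le_of_lattice_le h.ge) (le_of_lattice_le h.le)
  subst hm
  have hi := index_latticeOf (⟨m, l, x⟩ : LatticeData p)
  rw [h, index_latticeOf] at hi
  have hl : l = l' := by
    have := Nat.pow_right_injective (Fact.out : p.Prime).two_le hi
    simp only at this
    omega
  subst hl
  have : primLattice l x = primLattice l x' := by
    ext w
    rw [← smul_mem_lattice (m := m), ← smul_mem_lattice (m := m)]
    exact SetLike.ext_iff.1 h _
  rw [primLattice_injective l this]

/-- Let `p^a`, `p^b` generate the two coordinate projections of `S`. The smaller exponent is `m`. A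
vector of `S` attaining it generates `S` together with the part of `S` on the other axis, and the
ratio of its coordinates is the projective point. -/
lemma exists_latticeOf_eq {S : Submodule ℤ_[p] (ℤ_[p] × ℤ_[p])}
    (hS : S.toAddSubgroup.index ≠ 0) : ∃ c, latticeOf c = S := by
  have hi1 := index_eq_map_mul_comap LinearMap.fst_surjective
    (LinearMap.range_inr ℤ_[p] ℤ_[p] ℤ_[p]) S
  have hi2 := index_eq_map_mul_comap LinearMap.snd_surjective
    (LinearMap.range_inl ℤ_[p] ℤ_[p] ℤ_[p]) S
  obtain ⟨a, ha⟩ := exists_eq_span_of_index_ne_zero (left_ne_zero_of_mul (hi1 ▸ hS))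
  obtain ⟨b, hb⟩ := exists_eq_span_of_index_ne_zero (left_ne_zero_of_mul (hi2 ▸ hS))
  obtain ⟨c, hc⟩ := exists_eq_span_of_index_ne_zero (right_ne_zero_of_mul (hi1 ▸ hS))
  obtain ⟨c', hc'⟩ := exists_eq_span_of_index_ne_zero (right_ne_zero_of_mul (hi2 ▸ hS))
  have ha1 : ∀ u ∈ S, (p : ℤ_[p]) ^ a ∣ u.1 := fun u hu => by
    rw [← mem_span_p_pow, ← ha]; exact ⟨u, hu, rfl⟩
  have hb1 : ∀ u ∈ S, (p : ℤ_[p]) ^ b ∣ u.2 := fun u hu => by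
    rw [← mem_span_p_pow, ← hb]; exact ⟨u, hu, rfl⟩
  have hc1 : ∀ z : ℤ_[p], (0, z) ∈ S ↔ (p : ℤ_[p]) ^ c ∣ z := fun z => by
    rw [← mem_span_p_pow, ← hc]; rfl
  have hc1' : ∀ z : ℤ_[p], (z, 0) ∈ S ↔ (p : ℤ_[p]) ^ c' ∣ z := fun z => by
    rw [← mem_span_p_pow, ← hc']; rfl
  have hpow : ∀ {i j : ℕ}, (p : ℤ_[p]) ^ i ∣ (p : ℤ_[p]) ^ j ↔ i ≤ j := fun {i j} =>
    pow_dvd_pow_iff p_ne_zero PadicInt.prime_p.not_isUnit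
  have hbc : b ≤ c := hpow.1 (hb1 _ ((hc1 _).2 dvd_rfl))
  have hac' : a ≤ c' := hpow.1 (ha1 _ ((hc1' _).2 dvd_rfl))
  rcases le_or_gt a b with hab | hab
  · obtain ⟨l, rfl⟩ := Nat.exists_eq_add_of_le (hab.trans hbc)
    obtain ⟨w, hw, hw1⟩ : (p : ℤ_[p]) ^ a ∈ S.map (LinearMap.fst ℤ_[p] ℤ_[p] ℤ_[p]) := by
      rw [ha]; exact mem_span_p_pow.2 dvd_rfl
    obtain ⟨x, hx⟩ := (hpow.2 hab).trans (hb1 w hw)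
    have hw' : w = ((p : ℤ_[p]) ^ a, (p : ℤ_[p]) ^ a * x) := Prod.ext hw1 hx
    refine ⟨⟨a, l, .inl (PadicInt.toZModPow l x)⟩, ?_⟩
    ext u
    have key : ∀ v : ℤ_[p] × ℤ_[p], v ∈ primLattice l (.inl (PadicInt.toZModPow l x)) ↔
        (p : ℤ_[p]) ^ a • v ∈ S := fun v => by
      rw [mem_primLattice_inl_iff_dvd, ← S.sub_mem_iff_left (S.smul_mem v.1 hw), hw']
      have : (p : ℤ_[p]) ^ a • v - v.1 • ((p : ℤ_[p]) ^ a, (p : ℤ_[p]) ^ a * x) =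
          (0, (p : ℤ_[p]) ^ a * (v.2 - x * v.1)) := by
        ext
        · simp [mul_comm]
        · simp; ring
      rw [this, hc1, pow_add, mul_dvd_mul_iff_left (pow_ne_zero _ p_ne_zero)]
    rw [latticeOf, mem_lattice]
    constructor
    · rintro ⟨v, hv, rfl⟩
      exact (key v).1 hv
    · intro hu
      obtain ⟨v1, h1⟩ := ha1 u hu
      obtain ⟨v2, h2⟩ := (hpow.2 hab).trans (hb1 u hu)
      have hu' : (p : ℤ_[p]) ^ a • (v1, v2) = u := Prod.ext h1.symm h2.symm
      exact ⟨(v1, v2), (key _).2 (hu' ▸ hu), hu'⟩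
  · obtain ⟨l, rfl⟩ := Nat.exists_eq_add_of_le (hab.le.trans hac')
    obtain ⟨w, hw, hw1⟩ : (p : ℤ_[p]) ^ b ∈ S.map (LinearMap.snd ℤ_[p] ℤ_[p] ℤ_[p]) := by
      rw [hb]; exact mem_span_p_pow.2 dvd_rfl
    obtain ⟨y, hy⟩ := (hpow.2 hab.le).trans (ha1 w hw)
    have hw' : w = ((p : ℤ_[p]) ^ b * y, (p : ℤ_[p]) ^ b) := Prod.ext hy hw1
    -- The strict inequality `b < a` puts the ratio in the maximal ideal, and it also makes `l`
    -- nonzero, so the point belongs to the second chart only.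
    have hpy : (p : ℤ_[p]) ∣ y := by
      have := (hpow.2 (Nat.succ_le_of_lt hab)).trans (ha1 w hw)
      rwa [hy, pow_succ, mul_dvd_mul_iff_left (pow_ne_zero _ p_ne_zero)] at this
    have hyn : ¬ IsUnit (PadicInt.toZModPow l y) := not_isUnit_toZModPow (by omega) hpy
    refine ⟨⟨b, l, .inr ⟨PadicInt.toZModPow l y, hyn⟩⟩, ?_⟩
    ext u
    have key : ∀ v : ℤ_[p] × ℤ_[p], v ∈ primLattice l (.inr ⟨PadicInt.toZModPow l y, hyn⟩) ↔
        (p : ℤ_[p]) ^ b • v ∈ S := fun v => by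
      rw [mem_primLattice_inr_iff_dvd, ← S.sub_mem_iff_left (S.smul_mem v.2 hw), hw']
      have : (p : ℤ_[p]) ^ b • v - v.2 • ((p : ℤ_[p]) ^ b * y, (p : ℤ_[p]) ^ b) =
          ((p : ℤ_[p]) ^ b * (v.1 - y * v.2), 0) := by
        ext
        · simp; ring
        · simp [mul_comm]
      rw [this, hc1', pow_add, mul_dvd_mul_iff_left (pow_ne_zero _ p_ne_zero)]
    rw [latticeOf, mem_lattice]
    constructor
    · rintro ⟨v, hv, rfl⟩
      exact (key v).1 hv
    · intro hu
      obtain ⟨v1, h1⟩ := (hpow.2 hab.le).trans (ha1 u hu)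
      obtain ⟨v2, h2⟩ := hb1 u hu
      have hu' : (p : ℤ_[p]) ^ b • (v1, v2) = u := Prod.ext h1.symm h2.symm
      exact ⟨(v1, v2), (key _).2 (hu' ▸ hu), hu'⟩

end Lattices

/-! ### Subalgebras of finite index as triples: image, plane lattice, coset -/

section Subalgebras

variable {p : ℕ} [Fact p.Prime] {L : Type*} [LieRing L] [LieAlgebra ℤ_[p] L]

/-- The embedding of `ℤ_p²` as the span of the last two basis vectors. -/
def planeIncl (e : Module.Basis (Fin 3) ℤ_[p] L) : ℤ_[p] × ℤ_[p] →ₗ[ℤ_[p]] L :=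
  (LinearMap.toSpanSingleton ℤ_[p] L (e 1)).coprod (LinearMap.toSpanSingleton ℤ_[p] L (e 2))

/-- The last two coordinates. -/
def planeProj (e : Module.Basis (Fin 3) ℤ_[p] L) : L →ₗ[ℤ_[p]] ℤ_[p] × ℤ_[p] :=
  (e.coord 1).prod (e.coord 2)

variable (e : Module.Basis (Fin 3) ℤ_[p] L)

lemma planeIncl_apply (u : ℤ_[p] × ℤ_[p]) : planeIncl e u = u.1 • e 1 + u.2 • e 2 := by
  simp [planeIncl]

@[simp] lemma coord_zero_planeIncl (u : ℤ_[p] × ℤ_[p]) : e.coord 0 (planeIncl e u) = 0 := by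
  simp [planeIncl_apply]

@[simp] lemma planeProj_planeIncl (u : ℤ_[p] × ℤ_[p]) : planeProj e (planeIncl e u) = u := by
  ext <;> simp [planeIncl_apply, planeProj]

@[simp] lemma planeProj_basis_zero : planeProj e (e 0) = 0 := by
  ext <;> simp [planeProj]

lemma coord_zero_basis_zero : e.coord 0 (e 0) = 1 := by simp

lemma coord_smul_add_planeIncl (x : L) :
    e.coord 0 x • e 0 + planeIncl e (planeProj e x) = x := by
  conv_rhs => rw [← e.sum_repr x, Fin.sum_univ_three]
  simp [planeIncl_apply, planeProj, add_assoc]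

lemma planeIncl_planeProj {x : L} (hx : e.coord 0 x = 0) : planeIncl e (planeProj e x) = x := by
  conv_rhs => rw [← coord_smul_add_planeIncl e x, hx, zero_smul, zero_add]

lemma coord_zero_surjective : Function.Surjective (e.coord 0) := fun a =>
  ⟨a • e 0, by simp⟩

lemma range_planeIncl : LinearMap.range (planeIncl e) = LinearMap.ker (e.coord 0) := by
  ext x
  constructor
  · rintro ⟨u, rfl⟩
    exact coord_zero_planeIncl e u
  · exact fun hx => ⟨_, planeIncl_planeProj e hx⟩

variable {e} {a q d : ℤ_[p]}

lemma IsNormalBasis.lie_planeIncl_planeIncl (h : IsNormalBasis e a q d) (u w : ℤ_[p] × ℤ_[p]) :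
    ⁅planeIncl e u, planeIncl e w⁆ = 0 := by
  have h21 : ⁅e 2, e 1⁆ = 0 := by rw [← lie_skew, h.bracket12, neg_zero]
  simp [planeIncl_apply, h.bracket12, h21]

lemma IsNormalBasis.lie_basis_zero (h : IsNormalBasis e a q d) (u : ℤ_[p] × ℤ_[p]) :
    ⁅e 0, planeIncl e u⁆ = planeIncl e (a • u - q • (u.2, d * u.1)) := by
  simp only [planeIncl_apply, lie_add, lie_smul, h.bracket01, h.bracket02, Prod.fst_sub,
    Prod.snd_sub, Prod.smul_fst, Prod.smul_snd, smul_eq_mul]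
  module

/-- The plane is abelian, so only the brackets of `e 0` with plane vectors survive. -/
lemma IsNormalBasis.lie_eq (h : IsNormalBasis e a q d) (x y : L) :
    ⁅x, y⁆ = ⁅e 0, planeIncl e (e.coord 0 x • planeProj e y - e.coord 0 y • planeProj e x)⁆ := by
  conv_lhs => rw [← coord_smul_add_planeIncl e x, ← coord_smul_add_planeIncl e y]
  simp only [lie_add, add_lie, lie_smul, smul_lie, lie_self, h.lie_planeIncl_planeIncl, map_sub,
    map_smul, lie_sub]
  rw [← lie_skew (planeIncl e (planeProj e x))]
  module

/-- The submodule of `L` that projects onto `p^n ℤ_p`, meets the plane in `Λ`, and over `p^n`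
consists of the coset `v`. -/
def submoduleOf (e : Module.Basis (Fin 3) ℤ_[p] L) (n : ℕ)
    (Λ : Submodule ℤ_[p] (ℤ_[p] × ℤ_[p])) (v : (ℤ_[p] × ℤ_[p]) ⧸ Λ) : Submodule ℤ_[p] L where
  carrier := {x | ∃ k, e.coord 0 x = (p : ℤ_[p]) ^ n * k ∧ Λ.mkQ (planeProj e x) = k • v}
  add_mem' := by
    rintro x y ⟨k, hk, hk'⟩ ⟨l, hl, hl'⟩
    exact ⟨k + l, by rw [map_add, hk, hl, mul_add], by rw [map_add, map_add, hk', hl', add_smul]⟩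
  zero_mem' := ⟨0, by simp, by simp⟩
  smul_mem' := by
    rintro c x ⟨k, hk, hk'⟩
    exact ⟨c * k, by rw [map_smul, hk, smul_eq_mul]; ring, by
      rw [map_smul, map_smul, hk', mul_smul]⟩

lemma mem_submoduleOf {n : ℕ} {Λ : Submodule ℤ_[p] (ℤ_[p] × ℤ_[p])}
    {v : (ℤ_[p] × ℤ_[p]) ⧸ Λ} {x : L} : x ∈ submoduleOf e n Λ v ↔
      ∃ k, e.coord 0 x = (p : ℤ_[p]) ^ n * k ∧ Λ.mkQ (planeProj e x) = k • v := Iff.rfl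

lemma planeIncl_mem_submoduleOf {n : ℕ} {Λ : Submodule ℤ_[p] (ℤ_[p] × ℤ_[p])}
    {v : (ℤ_[p] × ℤ_[p]) ⧸ Λ} {u : ℤ_[p] × ℤ_[p]} :
    planeIncl e u ∈ submoduleOf e n Λ v ↔ u ∈ Λ := by
  rw [mem_submoduleOf]
  simp only [coord_zero_planeIncl, planeProj_planeIncl]
  constructor
  · rintro ⟨k, hk, hk'⟩
    have : k = 0 := by
      rcases mul_eq_zero.1 hk.symm with h | h
      · exact absurd h (pow_ne_zero _ p_ne_zero)
      · exact h
    rw [this, zero_smul] at hk'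
    exact (Submodule.Quotient.mk_eq_zero Λ).1 hk'
  · intro hu
    exact ⟨0, by simp, by rw [zero_smul]; exact (Submodule.Quotient.mk_eq_zero Λ).2 hu⟩

lemma comap_submoduleOf (n : ℕ) (Λ : Submodule ℤ_[p] (ℤ_[p] × ℤ_[p]))
    (v : (ℤ_[p] × ℤ_[p]) ⧸ Λ) : (submoduleOf e n Λ v).comap (planeIncl e) = Λ := by
  ext u
  exact planeIncl_mem_submoduleOf

lemma exists_mem_submoduleOf (n : ℕ) {Λ : Submodule ℤ_[p] (ℤ_[p] × ℤ_[p])}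
    (v : (ℤ_[p] × ℤ_[p]) ⧸ Λ) : ∃ x ∈ submoduleOf e n Λ v, e.coord 0 x = (p : ℤ_[p]) ^ n ∧
      Λ.mkQ (planeProj e x) = v := by
  obtain ⟨u, rfl⟩ := Λ.mkQ_surjective v
  have h0 : e.coord 0 ((p : ℤ_[p]) ^ n • e 0 + planeIncl e u) = (p : ℤ_[p]) ^ n := by
    rw [map_add, map_smul, coord_zero_planeIncl, add_zero, coord_zero_basis_zero, smul_eq_mul,
      mul_one]
  have h1 : planeProj e ((p : ℤ_[p]) ^ n • e 0 + planeIncl e u) = u := by simp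
  exact ⟨_, ⟨1, by rw [h0, mul_one], by rw [h1, one_smul]⟩, h0, by rw [h1]⟩

lemma map_submoduleOf (n : ℕ) (Λ : Submodule ℤ_[p] (ℤ_[p] × ℤ_[p]))
    (v : (ℤ_[p] × ℤ_[p]) ⧸ Λ) :
    (submoduleOf e n Λ v).map (e.coord 0) = Ideal.span {(p : ℤ_[p]) ^ n} := by
  apply le_antisymm
  · rintro _ ⟨x, ⟨k, hk, -⟩, rfl⟩
    exact mem_span_p_pow.2 ⟨k, hk⟩
  · rw [Ideal.span_le, Set.singleton_subset_iff]
    obtain ⟨x, hx, hx', -⟩ := exists_mem_submoduleOf (e := e) n v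
    exact ⟨x, hx, hx'⟩

lemma index_submoduleOf (n : ℕ) (Λ : Submodule ℤ_[p] (ℤ_[p] × ℤ_[p]))
    (v : (ℤ_[p] × ℤ_[p]) ⧸ Λ) :
    (submoduleOf e n Λ v).toAddSubgroup.index = p ^ n * Λ.toAddSubgroup.index := by
  rw [index_eq_map_mul_comap (coord_zero_surjective e) (range_planeIncl e), map_submoduleOf,
    comap_submoduleOf, index_span_p_pow]

/-- Every submodule is of the form `submoduleOf`, if its projection is. -/
lemma eq_submoduleOf {S : Submodule ℤ_[p] L} {n : ℕ}
    (hS : S.map (e.coord 0) = Ideal.span {(p : ℤ_[p]) ^ n}) {x : L} (hx : x ∈ S)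
    (hx0 : e.coord 0 x = (p : ℤ_[p]) ^ n) :
    submoduleOf e n (S.comap (planeIncl e)) ((S.comap (planeIncl e)).mkQ (planeProj e x)) = S := by
  have key : ∀ (y : L) (k : ℤ_[p]), e.coord 0 y = (p : ℤ_[p]) ^ n * k →
      ((S.comap (planeIncl e)).mkQ (planeProj e y) =
        k • (S.comap (planeIncl e)).mkQ (planeProj e x) ↔ y ∈ S) := by
    intro y k hk
    have h0 : e.coord 0 (y - k • x) = 0 := by
      rw [map_sub, map_smul, hk, hx0, smul_eq_mul]; ring
    rw [← map_smul, ← sub_eq_zero, ← map_sub, ← map_smul, ← map_sub, Submodule.mkQ_apply,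
      Submodule.Quotient.mk_eq_zero, Submodule.mem_comap, planeIncl_planeProj e h0,
      S.sub_mem_iff_left (S.smul_mem k hx)]
  ext y
  rw [mem_submoduleOf]
  constructor
  · rintro ⟨k, hk, hk'⟩
    exact (key y k hk).1 hk'
  · intro hy
    obtain ⟨k, hk⟩ : (p : ℤ_[p]) ^ n ∣ e.coord 0 y := by
      rw [← mem_span_p_pow, ← hS]
      exact ⟨y, hy, rfl⟩
    exact ⟨k, hk, (key y k hk).2 hy⟩

/-- The condition on `n` and `Λ` that makes `submoduleOf` a subalgebra. -/
def Compatible (q d : ℤ_[p]) (n : ℕ) (Λ : Submodule ℤ_[p] (ℤ_[p] × ℤ_[p])) : Prop :=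
  ∀ u ∈ Λ, ((p : ℤ_[p]) ^ n * q) • (u.2, d * u.1) ∈ Λ

lemma IsNormalBasis.lie_mem_submoduleOf (h : IsNormalBasis e a q d) {n : ℕ}
    {Λ : Submodule ℤ_[p] (ℤ_[p] × ℤ_[p])} (hc : Compatible q d n Λ)
    {v : (ℤ_[p] × ℤ_[p]) ⧸ Λ} {x y : L} (hx : x ∈ submoduleOf e n Λ v)
    (hy : y ∈ submoduleOf e n Λ v) : ⁅x, y⁆ ∈ submoduleOf e n Λ v := by
  obtain ⟨k, hk, hk'⟩ := hx
  obtain ⟨l, hl, hl'⟩ := hy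
  set w := k • planeProj e y - l • planeProj e x with hw
  -- Modulo `Λ` the two plane components are `k • v` and `l • v`, so `w` becomes `k l v - l k v =
  -- 0`. The bracket is thus `p^n` times that of `e 0` with an element of `Λ`, whatever the coset
  -- `v`.
  have hwΛ : w ∈ Λ := by
    rw [← Submodule.Quotient.mk_eq_zero Λ, ← Submodule.mkQ_apply, hw, map_sub, map_smul, map_smul,
      hk', hl', smul_comm, sub_self]
  have he : e.coord 0 x • planeProj e y - e.coord 0 y • planeProj e x = (p : ℤ_[p]) ^ n • w := by
    rw [hk, hl, hw, smul_sub, mul_smul, mul_smul]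
  rw [h.lie_eq, he, h.lie_basis_zero, planeIncl_mem_submoduleOf]
  refine Λ.sub_mem (Λ.smul_mem _ (Λ.smul_mem _ hwΛ)) ?_
  convert! hc w hwΛ using 1
  ext
  · simp; ring
  · simp; ring

/-- Bracketing an element over `p^n` with `Λ` gives `p^n (a - q N) Λ`, and the scalar part already
lies in `Λ`. -/
lemma IsNormalBasis.compatible (h : IsNormalBasis e a q d) (H : LieSubalgebra ℤ_[p] L) {n : ℕ}
    {x : L} (hx : x ∈ H) (hx0 : e.coord 0 x = (p : ℤ_[p]) ^ n) :
    Compatible q d n (H.toSubmodule.comap (planeIncl e)) := by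
  intro u hu
  have h1 : ⁅x, planeIncl e u⁆ ∈ H := H.lie_mem hx hu
  rw [h.lie_eq, coord_zero_planeIncl, zero_smul, sub_zero, planeProj_planeIncl, hx0,
    h.lie_basis_zero] at h1
  change _ ∈ H.toSubmodule.comap (planeIncl e) at h1
  rw [Submodule.sub_mem_iff_right _ (Submodule.smul_mem _ _ (Submodule.smul_mem _ _ hu))] at h1
  convert! h1 using 1
  ext
  · simp; ring
  · simp; ring

/-- The parameters of the subalgebras of index `p^(n + 2m + l)`: a compatible lattice `p^m Λ`, where
`Λ` is given by a point of the projective line over `ℤ/p^l`, and a coset of this lattice. -/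
abbrev SubalgebraFiber (q d : ℤ_[p]) (z : ℕ × ℕ × ℕ) : Type :=
  Σ x : {x : ProjPoint p z.2.2 // Compatible q d z.1 (lattice z.2.1 z.2.2 x)},
    (ℤ_[p] × ℤ_[p]) ⧸ lattice z.2.1 z.2.2 x.1

/-- The data can be read off from a subalgebra: `n` from its image, `(m, l, x)` from its
intersection with the plane, and the coset from any element over `p^n`. -/
lemma IsNormalBasis.exists_equiv (h : IsNormalBasis e a q d) :
    ∃ E : (Σ z : ℕ × ℕ × ℕ, SubalgebraFiber q d z) ≃ FiniteIndexSubalgebra p L,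
      ∀ z, subIndex p L (E z).1 = p ^ (z.1.1 + 2 * z.1.2.1 + z.1.2.2) := by
  let F : (Σ z : ℕ × ℕ × ℕ, SubalgebraFiber q d z) → LieSubalgebra ℤ_[p] L := fun z =>
    { submoduleOf e z.1.1 (lattice z.1.2.1 z.1.2.2 z.2.1.1) z.2.2 with
      lie_mem' := fun hx hy => h.lie_mem_submoduleOf z.2.1.2 hx hy }
  have hF : ∀ z, (F z).toSubmodule =
      submoduleOf e z.1.1 (lattice z.1.2.1 z.1.2.2 z.2.1.1) z.2.2 := fun z => rfl
  have hidx : ∀ z, subIndex p L (F z) = p ^ (z.1.1 + 2 * z.1.2.1 + z.1.2.2) := fun z => by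
    rw [subIndex, hF, index_submoduleOf, index_lattice, ← pow_add, add_assoc]
  let G : (Σ z : ℕ × ℕ × ℕ, SubalgebraFiber q d z) → FiniteIndexSubalgebra p L := fun z =>
    ⟨F z, by rw [hidx]; exact pow_ne_zero _ (NeZero.ne p)⟩
  have hinj : Function.Injective G := by
    intro z z' hz
    have hz1 : (F z).toSubmodule = (F z').toSubmodule := 
      congrArg (fun H : FiniteIndexSubalgebra p L => H.1.toSubmodule) hz
    obtain ⟨⟨n, m, l⟩, ⟨x, hx⟩, v⟩ := z
    obtain ⟨⟨n', m', l'⟩, ⟨x', hx'⟩, v'⟩ := z'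
    simp only [hF] at hz1
    have hn := congrArg (fun S => S.map (e.coord 0)) hz1
    simp only [map_submoduleOf] at hn
    obtain rfl := span_p_pow_injective hn
    have hΛ := congrArg (fun S => S.comap (planeIncl e)) hz1
    simp only [comap_submoduleOf] at hΛ
    have hc := latticeOf_injective (a₁ := (⟨m, l, x⟩ : LatticeData p)) (a₂ := ⟨m', l', x'⟩) hΛ
    obtain ⟨rfl, hlx⟩ := Prod.mk.inj hc
    obtain ⟨rfl, hxx⟩ := Sigma.mk.inj hlx
    obtain rfl := eq_of_heq hxx
    obtain ⟨y, hy, hy0, hyv⟩ := exists_mem_submoduleOf (e := e) n v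
    rw [hz1] at hy
    obtain ⟨k, hk, hk'⟩ := hy
    have hk1 : k = 1 := by
      rw [hy0] at hk
      exact mul_left_cancel₀ (pow_ne_zero n p_ne_zero) (by rw [← hk, mul_one])
    rw [hyv, hk1, one_smul] at hk'
    rw [hk']
  have hsurj : Function.Surjective G := by
    rintro ⟨H, hH⟩
    have hi := index_eq_map_mul_comap (coord_zero_surjective e) (range_planeIncl e) H.toSubmodule
    have hH' : H.toSubmodule.toAddSubgroup.index ≠ 0 := hH
    rw [hi] at hH'
    obtain ⟨n, hn⟩ := exists_eq_span_of_index_ne_zero (left_ne_zero_of_mul hH')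
    obtain ⟨x, hx, hx0⟩ : (p : ℤ_[p]) ^ n ∈ H.toSubmodule.map (e.coord 0) := by
      rw [hn]; exact mem_span_p_pow.2 dvd_rfl
    obtain ⟨⟨m, l, y⟩, hc⟩ := exists_latticeOf_eq (right_ne_zero_of_mul hH')
    have hcomp := h.compatible H hx hx0
    have hsub := eq_submoduleOf hn hx hx0
    rw [← hc] at hcomp hsub
    refine ⟨⟨⟨n, m, l⟩, ⟨y, hcomp⟩, (latticeOf ⟨m, l, y⟩).mkQ (planeProj e x)⟩, ?_⟩
    refine Subtype.ext (LieSubalgebra.toSubmodule_injective ?_)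
    exact hsub
  exact ⟨Equiv.ofBijective G ⟨hinj, hsurj⟩, hidx⟩

end Subalgebras

/-! ### Counting compatible lattices and cosets -/

section Counting

variable {p : ℕ} [Fact p.Prime]

lemma compatible_lattice_iff {q d : ℤ_[p]} {n m l : ℕ} {x : ProjPoint p l} :
    Compatible q d n (lattice m l x) ↔ Compatible q d n (primLattice l x) := by
  have hsm : ∀ w : ℤ_[p] × ℤ_[p], ((p : ℤ_[p]) ^ n * q) •
      (((p : ℤ_[p]) ^ m • w).2, d * ((p : ℤ_[p]) ^ m • w).1) =
      (p : ℤ_[p]) ^ m • ((p : ℤ_[p]) ^ n * q) • (w.2, d * w.1) := fun w => by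
    ext
    · simp; ring
    · simp; ring
  constructor
  · intro h w hw
    have := h _ (smul_mem_lattice.2 hw)
    rwa [hsm, smul_mem_lattice] at this
  · intro h u hu
    obtain ⟨w, hw, rfl⟩ := mem_lattice.1 hu
    rw [hsm, smul_mem_lattice]
    exact h w hw

/-- The lattice is generated by `(1, x)` and `p^l ℤ_p²`. Testing the generator, `p^(n+ι) (x, d)`
lies in it iff `p^(n+ι) (d - x²)` vanishes modulo `p^l`. -/
lemma compatible_inl_iff {d : ℤ_[p]} {n m l ι : ℕ} {x : ZMod (p ^ l)} :
    Compatible ((p : ℤ_[p]) ^ ι) d n (lattice m l (.inl x)) ↔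
      (p : ZMod (p ^ l)) ^ (n + ι) * (x ^ 2 - PadicInt.toZModPow l d) = 0 := by
  rw [compatible_lattice_iff]
  have key : ∀ w ∈ primLattice l (.inl x),
      (((p : ℤ_[p]) ^ n * (p : ℤ_[p]) ^ ι) • (w.2, d * w.1) ∈ primLattice l (.inl x) ↔
      (p : ZMod (p ^ l)) ^ (n + ι) * (x ^ 2 - PadicInt.toZModPow l d) *
        PadicInt.toZModPow l w.1 = 0) := by
    intro w hw
    rw [mem_primLattice_inl] at hw ⊢
    simp only [Prod.smul_snd, Prod.smul_fst, smul_eq_mul, map_mul, map_pow, map_natCast, hw]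
    rw [eq_comm, ← sub_eq_zero]
    constructor <;> intro h <;> linear_combination h
  constructor
  · intro h
    obtain ⟨z, rfl⟩ := toZModPow_surjective l x
    have h1 : ((1 : ℤ_[p]), z) ∈ primLattice l (.inl (PadicInt.toZModPow l z)) := by
      simp [mem_primLattice_inl]
    simpa using (key _ h1).1 (h _ h1)
  · intro h w hw
    rw [key w hw, h, zero_mul]

lemma p_pow_eq_zero_iff {l e : ℕ} : (p : ZMod (p ^ l)) ^ e = 0 ↔ l ≤ e := by
  rw [← map_natCast (PadicInt.toZModPow l : ℤ_[p] →+* ZMod (p ^ l)), ← map_pow,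
    toZModPow_eq_zero_iff, pow_dvd_pow_iff p_ne_zero PadicInt.prime_p.not_isUnit]

/-- The generator `(z, 1)` gives the condition `p^(n+ι) (1 - z² d) = 0`, in which the bracket is a
unit because `p` divides `z`. -/
lemma compatible_inr_iff {d : ℤ_[p]} {n m l ι : ℕ} {y : {y : ZMod (p ^ l) // ¬ IsUnit y}} :
    Compatible ((p : ℤ_[p]) ^ ι) d n (lattice m l (.inr y)) ↔ l ≤ n + ι := by
  rw [compatible_lattice_iff, ← p_pow_eq_zero_iff (p := p)]
  obtain ⟨z, hz, rfl⟩ := exists_lift_inr y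
  have hu : IsUnit (1 - PadicInt.toZModPow l z ^ 2 * PadicInt.toZModPow l d) := by
    rw [← map_one (PadicInt.toZModPow l), ← map_pow, ← map_mul, ← map_sub]
    refine (isUnit_iff_not_p_dvd.2 fun h => ?_).map _
    rw [dvd_sub_left (dvd_mul_of_dvd_left (dvd_pow (p_dvd_of_not_isUnit hz) two_ne_zero) _)] at h
    exact PadicInt.prime_p.not_dvd_one h
  have key : ∀ w ∈ primLattice l (.inr ⟨PadicInt.toZModPow l z, hz⟩),
      (((p : ℤ_[p]) ^ n * (p : ℤ_[p]) ^ ι) • (w.2, d * w.1) ∈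
        primLattice l (.inr ⟨PadicInt.toZModPow l z, hz⟩) ↔
      (p : ZMod (p ^ l)) ^ (n + ι) * (1 - PadicInt.toZModPow l z ^ 2 * PadicInt.toZModPow l d) *
        PadicInt.toZModPow l w.2 = 0) := by
    intro w hw
    rw [mem_primLattice_inr] at hw ⊢
    simp only [Prod.smul_snd, Prod.smul_fst, smul_eq_mul, map_mul, map_pow, map_natCast, hw]
    rw [← sub_eq_zero]
    constructor <;> intro h <;> linear_combination h
  constructor
  · intro h
    have h1 : (z, (1 : ℤ_[p])) ∈ primLattice l (.inr ⟨PadicInt.toZModPow l z, hz⟩) := by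
      simp [mem_primLattice_inr]
    have h2 := (key _ h1).1 (h _ h1)
    rw [map_one, mul_one] at h2
    exact (hu.mul_left_eq_zero).1 h2
  · intro h w hw
    rw [key w hw, h, zero_mul, zero_mul]

lemma card_not_isUnit (l : ℕ) : Nat.card {y : ZMod (p ^ (l + 1)) // ¬ IsUnit y} = p ^ l := by
  have h := haarOne_real_preimage (p := p) (l + 1) {y | ¬ IsUnit y}
  have h1 : (PadicInt.toZModPow (l + 1) : ℤ_[p] → ZMod (p ^ (l + 1))) ⁻¹' {y | ¬ IsUnit y} =
      {x : ℤ_[p] | (p : ℤ_[p]) ^ 1 ∣ x} := by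
    ext x
    rw [Set.mem_ofPred_eq, pow_one]
    exact ⟨p_dvd_of_not_isUnit, not_isUnit_toZModPow (Nat.succ_ne_zero l)⟩
  rw [h1, haarOne_real_dvd] at h
  have hp : (p : ℝ) ≠ 0 := Nat.cast_ne_zero.2 (NeZero.ne p)
  rw [eq_div_iff (pow_ne_zero _ hp)] at h
  have h2 : ((Nat.card {y : ZMod (p ^ (l + 1)) // ¬ IsUnit y} : ℕ) : ℝ) = ((p ^ l : ℕ) : ℝ) := by
    push_cast
    refine h.symm.trans ?_
    field_simp
    ring
  exact_mod_cast h2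

omit [Fact p.Prime] in
lemma card_projPoint_zero : Nat.card (ProjPoint p 0) = 1 := by
  have : IsEmpty {y : ZMod (p ^ 0) // ¬ IsUnit y} := by
    refine ⟨fun y => y.2 ?_⟩
    have : Subsingleton (ZMod (p ^ 0)) := by rw [pow_zero]; infer_instance
    exact isUnit_of_subsingleton _
  rw [Nat.card_sum, Nat.card_zmod, Nat.card_of_isEmpty, pow_zero]

lemma card_projPoint_succ (l : ℕ) : Nat.card (ProjPoint p (l + 1)) = p ^ (l + 1) + p ^ l := by
  rw [Nat.card_sum, Nat.card_zmod, card_not_isUnit]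

lemma card_projPoint_le (l : ℕ) : Nat.card (ProjPoint p l) ≤ 2 * p ^ l := by
  cases l with
  | zero => rw [card_projPoint_zero]; simp
  | succ l =>
    rw [card_projPoint_succ, two_mul]
    gcongr
    · exact NeZero.one_le
    · omega

/-- The number of compatible points of the projective line. -/
def compatCount (d : ℤ_[p]) (ι n l : ℕ) : ℕ :=
  Nat.card {x : ProjPoint p l // Compatible ((p : ℤ_[p]) ^ ι) d n (lattice 0 l x)}

lemma compatCount_of_le (d : ℤ_[p]) {ι n l : ℕ} (h : l ≤ n + ι) :
    compatCount d ι n l = Nat.card (ProjPoint p l) := by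
  refine Nat.card_congr (Equiv.subtypeUnivEquiv fun x => ?_)
  cases x with
  | inl x => rw [compatible_inl_iff, p_pow_eq_zero_iff.2 h, zero_mul]
  | inr y => rwa [compatible_inr_iff]

/-- No point of the second chart is compatible here. In the first, `p^(n+ι)` cancels and leaves `x²
≡ d` modulo `p^(j+1)`; the number of residues is `p^l` times the measure of its solution set. -/
lemma compatCount_of_gt (hp : 3 ≤ p) {d : ℤ_[p]} {star : Star} {k : ℕ} (hd : HasType d star k)
    (ι n j : ℕ) : (compatCount d ι n (n + ι + (j + 1)) : ℝ) =
      (p : ℝ) ^ (n + ι + (j + 1)) * sqDensity p star k (j + 1) := by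
  set l := n + ι + (j + 1) with hl
  have h1 : compatCount d ι n l = Nat.card {x : ZMod (p ^ l) |
      (p : ZMod (p ^ l)) ^ (n + ι) * (x ^ 2 - PadicInt.toZModPow l d) = 0} := by
    refine Nat.card_congr (Equiv.symm (Equiv.ofBijective
      (fun x => ⟨.inl x.1, compatible_inl_iff.2 x.2⟩) ⟨fun x x' h => ?_, ?_⟩))
    · exact Subtype.ext (Sum.inl_injective (congrArg Subtype.val h))
    · rintro ⟨x | y, hx⟩
      · exact ⟨⟨x, compatible_inl_iff.1 hx⟩, rfl⟩
      · rw [compatible_inr_iff] at hx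
        omega
  have h2 := haarOne_real_preimage (p := p) l {x : ZMod (p ^ l) |
      (p : ZMod (p ^ l)) ^ (n + ι) * (x ^ 2 - PadicInt.toZModPow l d) = 0}
  rw [← h1, eq_div_iff (pow_ne_zero _ (Nat.cast_ne_zero.2 (NeZero.ne p)))] at h2
  rw [← h2, ← hd.density hp, mul_comm]
  congr 2
  ext x
  simp only [Set.mem_preimage, Set.mem_ofPred_eq]
  rw [← map_natCast (PadicInt.toZModPow l : ℤ_[p] →+* ZMod (p ^ l)), ← map_pow, ← map_pow,
    ← map_sub, ← map_mul, toZModPow_eq_zero_iff, hl, pow_add _ (n + ι),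
    mul_dvd_mul_iff_left (pow_ne_zero _ p_ne_zero)]

instance finite_quotient_lattice (m l : ℕ) (x : ProjPoint p l) :
    Finite ((ℤ_[p] × ℤ_[p]) ⧸ lattice m l x) :=
  Nat.finite_of_card_ne_zero (by
    have := index_lattice m l x
    change Nat.card ((ℤ_[p] × ℤ_[p]) ⧸ lattice m l x) = _ at this
    rw [this]
    exact pow_ne_zero _ (NeZero.ne p))

lemma card_quotient_lattice (m l : ℕ) (x : ProjPoint p l) :
    Nat.card ((ℤ_[p] × ℤ_[p]) ⧸ lattice m l x) = p ^ (2 * m + l) := index_lattice m l x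

lemma card_subalgebraFiber (d : ℤ_[p]) (ι n m l : ℕ) :
    Nat.card (SubalgebraFiber ((p : ℤ_[p]) ^ ι) d (n, m, l)) =
      compatCount d ι n l * p ^ (2 * m + l) := by
  classical
  have : Fintype {x : ProjPoint p l // Compatible ((p : ℤ_[p]) ^ ι) d n (lattice m l x)} :=
    Fintype.ofFinite _
  rw [Nat.card_sigma]
  simp only [card_quotient_lattice, Finset.sum_const, Finset.card_univ, smul_eq_mul]
  rw [← Nat.card_eq_fintype_card, compatCount]
  congr 1
  refine Nat.card_congr (Equiv.subtypeEquivRight fun x => ?_)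
  rw [compatible_lattice_iff, compatible_lattice_iff]

end Counting

/-! ### Summation over fibres and over `l` -/

section Summation

lemma hasSum_sigma_const {K : Type*} {B : K → Type*} [∀ k, Finite (B k)] {g : K → ℂ}
    (hs : Summable fun k => (Nat.card (B k) : ℝ) * ‖g k‖) :
    Summable (fun z : Σ k, B k => ‖g z.1‖) ∧
      HasSum (fun z : Σ k, B k => g z.1) (∑' k, (Nat.card (B k) : ℂ) * g k) := by
  have h1 : Summable (fun z : Σ k, B k => ‖g z.1‖) := by
    rw [summable_sigma_of_nonneg fun z => norm_nonneg _]
    refine ⟨fun k => Summable.of_finite, hs.congr fun k => ?_⟩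
    change _ = ∑' _ : B k, ‖g k‖
    rw [tsum_const, nsmul_eq_mul]
  refine ⟨h1, ?_⟩
  have h2 : Summable (fun z : Σ k, B k => g z.1) := h1.of_norm
  convert! h2.hasSum using 1
  rw [h2.tsum_sigma]
  congr 1
  funext k
  change _ = ∑' _ : B k, g k
  rw [tsum_const, nsmul_eq_mul]

variable {p : ℕ} [Fact p.Prime]

/-- Split at `l = n + ι`: up to there every point counts, beyond it the densities enter. The term `j
= 0` of `P` belongs to the finite part, hence `P - 1`. -/
lemma hasSum_compatCount (hp : 3 ≤ p) {d : ℤ_[p]} {star : Star} {k : ℕ} (hd : HasType d star k)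
    (ι n : ℕ) {X P : ℂ} (hP : HasSum (fun j => (sqDensity p star k j : ℂ) * (p * X) ^ j) P) :
    HasSum (fun l => (compatCount d ι n l : ℂ) * X ^ l)
      (∑ l ∈ Finset.range (n + ι + 1), (Nat.card (ProjPoint p l) : ℂ) * X ^ l +
        (p * X) ^ (n + ι) * (P - 1)) := by
  have h1 := (hasSum_nat_add_iff' 1).2 hP
  simp only [Finset.sum_range_one, sqDensity_zero_right, Complex.ofReal_one, pow_zero,
    mul_one] at h1
  rw [← hasSum_nat_add_iff' (n + ι + 1)]
  have h2 : ∑ l ∈ Finset.range (n + ι + 1), (compatCount d ι n l : ℂ) * X ^ l =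
      ∑ l ∈ Finset.range (n + ι + 1), (Nat.card (ProjPoint p l) : ℂ) * X ^ l := by
    refine Finset.sum_congr rfl fun l hl => ?_
    rw [compatCount_of_le d (Nat.lt_succ_iff.1 (Finset.mem_range.1 hl))]
  rw [h2, add_sub_cancel_left]
  convert! h1.mul_left ((p * X) ^ (n + ι)) using 2 with j
  have h3 := congrArg (fun r : ℝ => (r : ℂ)) (compatCount_of_gt hp hd ι n j)
  simp only [Complex.ofReal_natCast] at h3
  rw [show j + (n + ι + 1) = n + ι + (j + 1) by ring, h3]
  push_cast
  rw [pow_add X, mul_pow _ _ (n + ι), mul_pow _ _ (j + 1), pow_add (p : ℂ)]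
  ring

end Summation

/-! ### The zeta function on `Re s > 1` -/

section ZetaSum

variable {p : ℕ} [Fact p.Prime]

lemma p_cast_ne_zero : (p : ℂ) ≠ 0 := Nat.cast_ne_zero.2 (NeZero.ne p)

lemma sum_card_projPoint_le (N : ℕ) :
    ∑ l ∈ Finset.range N, (Nat.card (ProjPoint p l) : ℝ) ≤ 2 * (p : ℝ) ^ N := by
  have h : ∑ l ∈ Finset.range N, Nat.card (ProjPoint p l) ≤ 2 * p ^ N := by
    refine (Finset.sum_le_sum fun l _ => card_projPoint_le l).trans ?_
    rw [← Finset.mul_sum]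
    exact Nat.mul_le_mul_left _ (Nat.geomSum_lt (Fact.out : p.Prime).two_le
      (fun l hl => Finset.mem_range.1 hl)).le
  exact_mod_cast h

/-- With `r = ‖p T‖ < 1`, the sum over `l` weighted by `‖T‖^n` is bounded by two geometric terms: a
multiple of `r^n` from the full projective lines and one of `r^(2n)` from the densities. No
condition `p² T ≠ 1` is needed. -/
lemma summable_norm_compatCount (hp : 3 ≤ p) {d : ℤ_[p]} {star : Star} {k : ℕ}
    (hd : HasType d star k) (ι : ℕ) {T P : ℂ} (hT : ‖(p : ℂ) * T‖ < 1)
    (hP : HasSum (fun j => (sqDensity p star k j : ℂ) * (p * (p * T)) ^ j) P) :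
    Summable fun z : ℕ × ℕ =>
      ‖T ^ z.1 * ((compatCount d ι z.1 z.2 : ℂ) * (p * T) ^ z.2)‖ := by
  have hp1 := one_lt_p (p := p)
  set r : ℝ := ‖(p : ℂ) * T‖ with hr
  have hr0 : 0 ≤ r := norm_nonneg _
  have hTr : (p : ℝ) * ‖T‖ = r := by rw [hr, norm_mul, Complex.norm_natCast]
  obtain ⟨Q, hQ⟩ : ∃ Q : ℂ,
      HasSum (fun j => (sqDensity p star k j : ℂ) * (p * (r : ℂ)) ^ j) Q := by
    have h1 := hP.summable.norm
    have h2 : Summable fun j => sqDensity p star k j * (p * r) ^ j := by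
      refine h1.congr fun j => ?_
      rw [norm_mul, norm_pow, norm_mul, ← hr, Complex.norm_natCast, Complex.norm_real,
        Real.norm_of_nonneg (sqDensity_nonneg _ _ _)]
    refine ⟨_, (Complex.hasSum_ofReal.2 h2.hasSum).congr_fun fun j => by push_cast; rfl⟩
  rw [summable_prod_of_nonneg fun z => norm_nonneg _]
  have hcs := fun n => hasSum_compatCount hp hd ι n hQ
  have hsum : ∀ n, Summable fun l => (compatCount d ι n l : ℝ) * r ^ l := fun n => by
    have := (hcs n).summable
    exact_mod_cast this
  have hnorm : ∀ n l, ‖T ^ n * ((compatCount d ι n l : ℂ) * (p * T) ^ l)‖ =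
      ‖T‖ ^ n * ((compatCount d ι n l : ℝ) * r ^ l) := fun n l => by
    rw [norm_mul, norm_mul, norm_pow, norm_pow, Complex.norm_natCast]
  simp only [hnorm]
  refine ⟨fun n => (hsum n).mul_left _, ?_⟩
  simp only [tsum_mul_left]
  have hg1 : Summable fun n : ℕ => 2 * (p : ℝ) ^ (ι + 1) * r ^ n :=
    (summable_geometric_of_lt_one hr0 hT).mul_left _
  have hg2 : Summable fun n : ℕ => (p * r) ^ ι * ‖Q - 1‖ * (r ^ 2) ^ n :=
    (summable_geometric_of_lt_one (by positivity) (by nlinarith)).mul_left _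
  refine Summable.of_nonneg_of_le (fun n => ?_) (fun n => ?_) (hg1.add hg2)
  · exact mul_nonneg (by positivity) (tsum_nonneg fun l => by positivity)
  have h1 : ∑' l, (compatCount d ι n l : ℝ) * r ^ l ≤
      2 * (p : ℝ) ^ (n + ι + 1) + (p * r) ^ (n + ι) * ‖Q - 1‖ := by
    have h2 : ((∑' l, (compatCount d ι n l : ℝ) * r ^ l : ℝ) : ℂ) =
        ∑ l ∈ Finset.range (n + ι + 1), (Nat.card (ProjPoint p l) : ℂ) * (r : ℂ) ^ l +
        (p * (r : ℂ)) ^ (n + ι) * (Q - 1) := by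
      rw [← (hcs n).tsum_eq, Complex.ofReal_tsum]
      push_cast
      rfl
    have h3 : ‖((∑' l, (compatCount d ι n l : ℝ) * r ^ l : ℝ) : ℂ)‖ =
        ∑' l, (compatCount d ι n l : ℝ) * r ^ l := by
      rw [Complex.norm_real, Real.norm_of_nonneg (tsum_nonneg fun l => by positivity)]
    rw [← h3, h2]
    refine (norm_add_le _ _).trans (add_le_add ?_ ?_)
    · refine (norm_sum_le _ _).trans ((Finset.sum_le_sum fun l _ => ?_).trans
        (sum_card_projPoint_le (p := p) (n + ι + 1)))
      rw [norm_mul, norm_pow, Complex.norm_natCast, Complex.norm_real, Real.norm_of_nonneg hr0]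
      exact mul_le_of_le_one_right (by positivity) (pow_le_one₀ hr0 hT.le)
    · rw [norm_mul, norm_pow, norm_mul, Complex.norm_natCast, Complex.norm_real,
        Real.norm_of_nonneg hr0]
  calc ‖T‖ ^ n * ∑' l, (compatCount d ι n l : ℝ) * r ^ l
      ≤ ‖T‖ ^ n * (2 * (p : ℝ) ^ (n + ι + 1) + (p * r) ^ (n + ι) * ‖Q - 1‖) := by gcongr
    _ = 2 * (p : ℝ) ^ (ι + 1) * (p * ‖T‖) ^ n +
        (p * r) ^ ι * ‖Q - 1‖ * (r * (p * ‖T‖)) ^ n := by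
      rw [mul_pow _ _ n, mul_pow r, mul_pow (p : ℝ) ‖T‖, pow_add _ n ι, mul_pow _ _ n]
      ring
    _ = _ := by rw [hTr, sq]

lemma sum_range_card_projPoint {X : ℂ} (hX : (p : ℂ) * X ≠ 1) (N : ℕ) :
    ∑ l ∈ Finset.range (N + 1), (Nat.card (ProjPoint p l) : ℂ) * X ^ l =
      1 + (1 + (p : ℂ)⁻¹) * (p * X) * (1 - (p * X) ^ N) / (1 - p * X) := by
  have h1 : 1 - (p : ℂ) * X ≠ 0 := sub_ne_zero.2 hX.symm
  have hp0 := p_cast_ne_zero (p := p)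
  induction N with
  | zero => rw [Finset.sum_range_one, card_projPoint_zero]; simp
  | succ N ih =>
    rw [Finset.sum_range_succ, ih, card_projPoint_succ, eq_comm, ← sub_eq_zero]
    push_cast
    rw [mul_pow, mul_pow]
    field_simp
    ring

lemma hasSum_compatCount_prod (hp : 3 ≤ p) {d : ℤ_[p]} {star : Star} {k : ℕ}
    (hd : HasType d star k) (ι : ℕ) {T P : ℂ} (hT : ‖(p : ℂ) * T‖ < 1)
    (hY : (p : ℂ) * (p * T) ≠ 1)
    (hP : HasSum (fun j => (sqDensity p star k j : ℂ) * (p * (p * T)) ^ j) P) :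
    HasSum (fun z : ℕ × ℕ => T ^ z.1 * ((compatCount d ι z.1 z.2 : ℂ) * (p * T) ^ z.2))
      ((1 + (1 + (p : ℂ)⁻¹) * (p * (p * T)) / (1 - p * (p * T))) / (1 - T) +
        (p * (p * T)) ^ ι * (P - 1 - (1 + (p : ℂ)⁻¹) * (p * (p * T)) / (1 - p * (p * T))) /
          (1 - (p * T) ^ 2)) := by
  have hp1 := one_lt_p (p := p)
  have hS : Summable fun z : ℕ × ℕ => T ^ z.1 * ((compatCount d ι z.1 z.2 : ℂ) * (p * T) ^ z.2) :=
    (summable_norm_compatCount hp hd ι hT hP).of_norm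
  have hTn : ‖T‖ < 1 := by
    rw [norm_mul, Complex.norm_natCast] at hT
    nlinarith [norm_nonneg T]
  have hT2 : ‖((p : ℂ) * T) ^ 2‖ < 1 := by
    rw [norm_pow]
    exact pow_lt_one₀ (norm_nonneg _) hT two_ne_zero
  have hin : ∀ n, HasSum (fun l => T ^ n * ((compatCount d ι n l : ℂ) * (p * T) ^ l)) _ :=
    fun n => (hasSum_compatCount hp hd ι n hP).mul_left (T ^ n)
  have h1 := hS.hasSum.prod_fiberwise hin
  -- The sum over `l` is a constant plus a multiple of `(p² T)^n`. Multiplied by `T^n`, these give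
  -- geometric series of ratios `T` and `(p T)²`.
  have h2 := ((hasSum_geometric_of_norm_lt_one hTn).mul_left
    (1 + (1 + (p : ℂ)⁻¹) * (p * (p * T)) / (1 - p * (p * T)))).add
    ((hasSum_geometric_of_norm_lt_one hT2).mul_left
    ((p * (p * T)) ^ ι * (P - 1 - (1 + (p : ℂ)⁻¹) * (p * (p * T)) / (1 - p * (p * T)))))
  have h3 := h1.unique (h2.congr_fun fun n => ?_)
  · rw [div_eq_mul_inv _ (1 - T), div_eq_mul_inv _ (1 - ((p : ℂ) * T) ^ 2), ← h3]
    exact hS.hasSum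
  · have h4 : 1 - (p : ℂ) * (p * T) ≠ 0 := sub_ne_zero.2 hY.symm
    rw [sum_range_card_projPoint hY, pow_add _ n ι, show ((p : ℂ) * T) ^ 2 = p * (p * T) * T by ring,
      mul_pow _ T n]
    field_simp
    ring

lemma card_subalgebraFiber_mul (d : ℤ_[p]) (ι : ℕ) (T : ℂ) (n m l : ℕ) :
    (Nat.card (SubalgebraFiber ((p : ℤ_[p]) ^ ι) d (n, m, l)) : ℂ) * T ^ (n + 2 * m + l) =
      ((p * T) ^ 2) ^ m * (T ^ n * ((compatCount d ι n l : ℂ) * (p * T) ^ l)) := by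
  rw [card_subalgebraFiber]
  push_cast
  rw [mul_pow, mul_pow, mul_pow, pow_add, pow_add, pow_add, ← pow_mul, ← pow_mul]
  ring

/-- The sum over the fibres of `T ^ (n + 2m + l)`. -/
lemma hasSum_subalgebraFiber (hp : 3 ≤ p) {d : ℤ_[p]} {star : Star} {k : ℕ}
    (hd : HasType d star k) (ι : ℕ) {T P : ℂ} (hT : ‖(p : ℂ) * T‖ < 1)
    (hP : HasSum (fun j => (sqDensity p star k j : ℂ) * (p * (p * T)) ^ j) P) :
    Summable (fun z : Σ z : ℕ × ℕ × ℕ, SubalgebraFiber ((p : ℤ_[p]) ^ ι) d z =>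
      ‖T ^ (z.1.1 + 2 * z.1.2.1 + z.1.2.2)‖) ∧
    ((p : ℂ) * (p * T) ≠ 1 →
      HasSum (fun z : Σ z : ℕ × ℕ × ℕ, SubalgebraFiber ((p : ℤ_[p]) ^ ι) d z =>
        T ^ (z.1.1 + 2 * z.1.2.1 + z.1.2.2))
      ((1 - (p * T) ^ 2)⁻¹ *
        ((1 + (1 + (p : ℂ)⁻¹) * (p * (p * T)) / (1 - p * (p * T))) / (1 - T) +
        (p * (p * T)) ^ ι * (P - 1 - (1 + (p : ℂ)⁻¹) * (p * (p * T)) / (1 - p * (p * T))) /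
          (1 - (p * T) ^ 2)))) := by
  have hT2 : ‖((p : ℂ) * T) ^ 2‖ < 1 := by
    rw [norm_pow]
    exact pow_lt_one₀ (norm_nonneg _) hT two_ne_zero
  -- Compatibility is independent of `m`, so after moving `m` to the front the sum is a geometric
  -- series in `(p T)²` times the sum over `(n, l)`.
  let σ : ℕ × ℕ × ℕ ≃ ℕ × ℕ × ℕ :=
    ⟨fun z => (z.2.1, z.1, z.2.2), fun z => (z.2.1, z.1, z.2.2), fun _ => rfl, fun _ => rfl⟩
  have hg : Summable fun m : ℕ => ‖(((p : ℂ) * T) ^ 2) ^ m‖ := by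
    simp_rw [norm_pow]
    refine summable_geometric_of_lt_one (by positivity) ?_
    rwa [norm_pow] at hT2
  have hc := summable_norm_compatCount hp hd ι hT hP
  have hprod := summable_mul_of_summable_norm hg hc
  have hnorm := (hg.mul_norm hc)
  have hs : Summable fun z : ℕ × ℕ × ℕ =>
      (Nat.card (SubalgebraFiber ((p : ℤ_[p]) ^ ι) d z) : ℝ) *
        ‖T ^ (z.1 + 2 * z.2.1 + z.2.2)‖ := by
    refine (σ.summable_iff.2 hnorm).congr fun z => ?_
    obtain ⟨n, m, l⟩ := z
    change ‖((p * T) ^ 2) ^ m * (T ^ n * ((compatCount d ι n l : ℂ) * (p * T) ^ l))‖ = _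
    rw [← card_subalgebraFiber_mul, norm_mul, Complex.norm_natCast]
  have hfin : ∀ z : ℕ × ℕ × ℕ, Finite (SubalgebraFiber ((p : ℤ_[p]) ^ ι) d z) := fun z => by
    unfold SubalgebraFiber
    infer_instance
  obtain ⟨h1, h2⟩ := hasSum_sigma_const hs
  refine ⟨h1, fun hY => ?_⟩
  have h3 := (hasSum_geometric_of_norm_lt_one hT2).mul
    (hasSum_compatCount_prod hp hd ι hT hY hP) hprod
  have h4 := (σ.hasSum_iff.2 h3).tsum_eq
  rw [← h4]
  convert! h2 using 2
  funext z
  obtain ⟨n, m, l⟩ := z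
  exact (card_subalgebraFiber_mul d ι T n m l).symm

lemma norm_p_mul_cpow_lt {s : ℂ} (hs : 1 < s.re) : ‖(p : ℂ) * (p : ℂ) ^ (-s)‖ < 1 := by
  have h := norm_p_cpow_neg_lt (p := p) (s := s - 2) (by simp; linarith)
  have h2 : (p : ℂ) ^ (-(s - 2)) = p * (p * (p : ℂ) ^ (-s)) := by
    rw [neg_sub, sub_eq_add_neg, Complex.cpow_add _ _ p_cast_ne_zero]
    norm_cast
    push_cast
    ring
  rw [h2, norm_mul, Complex.norm_natCast] at h
  have hp := one_lt_p (p := p)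
  by_contra hcon
  nlinarith

lemma cpow_two_sub (s : ℂ) : (p : ℂ) ^ (2 - s) = p * (p * (p : ℂ) ^ (-s)) := by
  rw [sub_eq_add_neg, Complex.cpow_add _ _ p_cast_ne_zero]
  norm_cast
  push_cast
  ring

lemma localZeta_sub_one (s : ℂ) : localZeta p (s - 1) = (1 - p * (p : ℂ) ^ (-s))⁻¹ := by
  rw [localZeta, neg_sub, sub_eq_add_neg 1 s, Complex.cpow_add _ _ p_cast_ne_zero, Complex.cpow_one]

lemma localZeta_sub_two (s : ℂ) : localZeta p (s - 2) = (1 - p * (p * (p : ℂ) ^ (-s)))⁻¹ := by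
  rw [localZeta, neg_sub, cpow_two_sub]

lemma localZeta_two_mul_sub_two (s : ℂ) :
    localZeta p (2 * s - 2) = (1 - (p * (p : ℂ) ^ (-s)) ^ 2)⁻¹ := by
  rw [localZeta, show -(2 * s - 2) = (2 : ℕ) * (1 + -s) by push_cast; ring, Complex.cpow_nat_mul,
    Complex.cpow_add _ _ p_cast_ne_zero, Complex.cpow_one]

lemma one_sub_ne_zero_of_norm_lt {z : ℂ} (h : ‖z‖ < 1) : 1 - z ≠ 0 := by
  intro h0
  rw [← sub_eq_zero.1 h0, norm_one] at h
  exact lt_irrefl _ h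

/-- The algebraic identity behind the formula for the zeta function. -/
lemma zetaFormula_algebra {T X Y Z P c w y : ℂ} (hyY : y * Y = X) (hT : 1 - T ≠ 0)
    (hX : 1 - X ≠ 0) (hX2 : 1 - X ^ 2 ≠ 0) (hY : 1 - Y ≠ 0) (hc : c ≠ 0)
    (hZ : Y * (1 - X ^ 2) * Z = c * ((1 + X) - (1 - Y) * P)) :
    (1 - T)⁻¹ * (1 - X)⁻¹ * (1 - Y)⁻¹ - Z * (1 - X ^ 2)⁻¹ * (1 - Y)⁻¹ * (w * Y) * c⁻¹ =
      (1 - X ^ 2)⁻¹ * ((1 + (1 + y) * Y / (1 - Y)) / (1 - T) +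
        w * (P - 1 - (1 + y) * Y / (1 - Y)) / (1 - X ^ 2)) := by
  have h1 : (1 - X)⁻¹ = (1 + X) * (1 - X ^ 2)⁻¹ := by
    field_simp
    ring
  have h2 : Z * Y = c * ((1 + X) - (1 - Y) * P) / (1 - X ^ 2) := by
    rw [← hZ]
    field_simp
  have h3 : Z * (1 - X ^ 2)⁻¹ * (1 - Y)⁻¹ * (w * Y) * c⁻¹ =
      ((1 + X) - (1 - Y) * P) / (1 - X ^ 2) * (1 - X ^ 2)⁻¹ * (1 - Y)⁻¹ * w := by
    rw [show Z * (1 - X ^ 2)⁻¹ * (1 - Y)⁻¹ * (w * Y) * c⁻¹ =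
      Z * Y * (1 - X ^ 2)⁻¹ * (1 - Y)⁻¹ * w * c⁻¹ by ring, h2]
    field_simp
  rw [h3, h1, show (1 + y) * Y = Y + X by rw [← hyY]; ring]
  -- What remains holds with `1 - X²` replaced by an independent unknown, since `1 + (Y + X) / (1 -
  -- Y) = (1 + X) / (1 - Y)`.
  generalize 1 - X ^ 2 = D at *
  field_simp
  ring

lemma zetaFormula_eq {star : Star} {k ι : ℕ} {s : ℂ} {T P : ℂ} (hTs : (p : ℂ) ^ (-s) = T)
    (hT : ‖(p : ℂ) * T‖ < 1) (hY : (p : ℂ) * (p * T) ≠ 1)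
    (hZ : (p * (p * T)) * (1 - (p * (p * T) / p) ^ 2) * explicitZ p star k (s - 2) =
        (1 - (p : ℂ)⁻¹) * ((1 + p * (p * T) / p) - (1 - p * (p * T)) * P)) :
    zetaFormula p star k ι s = (1 - (p * T) ^ 2)⁻¹ *
        ((1 + (1 + (p : ℂ)⁻¹) * (p * (p * T)) / (1 - p * (p * T))) / (1 - T) +
        (p * (p * T)) ^ ι * (P - 1 - (1 + (p : ℂ)⁻¹) * (p * (p * T)) / (1 - p * (p * T))) /
          (1 - (p * T) ^ 2)) := by
  have hp0 := p_cast_ne_zero (p := p)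
  have hXp : (p : ℂ) * (p * T) / p = p * T := by field_simp
  rw [hXp] at hZ
  have hX3 : 1 - ((p : ℂ) * T) ^ 2 ≠ 0 := one_sub_ne_zero_of_norm_lt (by
    rw [norm_pow]
    exact pow_lt_one₀ (norm_nonneg _) hT two_ne_zero)
  have hT1 : 1 - T ≠ 0 := by
    refine one_sub_ne_zero_of_norm_lt ?_
    rw [norm_mul, Complex.norm_natCast] at hT
    nlinarith [norm_nonneg T, one_lt_p (p := p)]
  have hpow : (p : ℂ) ^ ((2 - s) * ((ι : ℂ) + 1)) = (p * (p * T)) ^ (ι + 1) := by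
    rw [mul_comm, ← hTs, ← cpow_two_sub, ← Complex.cpow_nat_mul]
    push_cast
    rfl
  rw [zetaFormula, abelianZeta, localZeta_sub_one, localZeta_sub_two, localZeta_two_mul_sub_two,
    localZeta, hTs, hpow]
  rw [pow_succ]
  exact zetaFormula_algebra (by field_simp) hT1 (one_sub_ne_zero_of_norm_lt hT) hX3
    (sub_ne_zero.2 hY.symm) one_sub_p_inv_ne_zero hZ

variable {L : Type*} [LieRing L] [LieAlgebra ℤ_[p] L]

/-- Absolute convergence of the zeta function, and its value. -/
lemma IsNormalBasis.zeta (hp : 3 ≤ p) {e : Module.Basis (Fin 3) ℤ_[p] L} {a d : ℤ_[p]} {ι : ℕ}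
    (h : IsNormalBasis e a ((p : ℤ_[p]) ^ ι) d) {star : Star} {k : ℕ} (hd : HasType d star k)
    {s : ℂ} (hs : 1 < s.re) :
    Summable (zetaTerm p L s) ∧
      ((p : ℂ) ^ (2 - s) ≠ 1 → subalgebraZeta p L s = zetaFormula p star k ι s) := by
  obtain ⟨E, hE⟩ := h.exists_equiv
  set T : ℂ := (p : ℂ) ^ (-s) with hTs
  have hT : ‖(p : ℂ) * T‖ < 1 := norm_p_mul_cpow_lt hs
  have hY : (p : ℂ) ^ (-(s - 2)) = p * (p * T) := by rw [neg_sub, cpow_two_sub]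
  -- The density series is taken at `t = p^(2-s)`; `Re s > 1` amounts to `‖t‖ < p`, the half-plane
  -- of Igusa's integral shifted by 2.
  obtain ⟨P, hP, hZ⟩ := exists_hasSum_sqDensity star k hY
    (hY ▸ norm_p_cpow_neg_lt (by simp; linarith))
  obtain ⟨h1, h2⟩ := hasSum_subalgebraFiber hp hd ι hT hP
  have hterm : zetaTerm p L s ∘ E = fun z => T ^ (z.1.1 + 2 * z.1.2.1 + z.1.2.2) := by
    funext z
    rw [Function.comp_apply, zetaTerm, hE, Nat.cast_pow, ← Complex.natCast_cpow_natCast_mul,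
      Complex.cpow_nat_mul]
  constructor
  · rw [← E.summable_iff, hterm]
    exact h1.of_norm
  · intro hne
    rw [cpow_two_sub] at hne
    have h3 := h2 hne
    rw [← hterm, E.hasSum_iff] at h3
    rw [subalgebraZeta, h3.tsum_eq, zetaFormula_eq rfl hT hne hZ]

end ZetaSum

/-! ### The abscissa of convergence -/

section Abscissa

variable {p : ℕ} [Fact p.Prime] {L : Type*} [LieRing L] [LieAlgebra ℤ_[p] L]

lemma hasSum_subalgebraCount {s : ℂ} (hs : Summable (zetaTerm p L s)) :
    HasSum (fun n : ℕ => if n = 0 then 0 else (subalgebraCount p L n : ℂ) * (n : ℂ) ^ (-s))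
      (subalgebraZeta p L s) := by
  have h := hs.hasSum.tsum_fiberwise (fun H => subIndex p L H.1)
  convert! h using 2 with n
  have hterm : ∀ H : (fun H : FiniteIndexSubalgebra p L => subIndex p L H.1) ⁻¹' {n},
      zetaTerm p L s H = (n : ℂ) ^ (-s) := fun H => by
    have : subIndex p L H.1.1 = n := H.2
    rw [zetaTerm, this]
  simp_rw [hterm]
  rw [tsum_const, nsmul_eq_mul]
  split_ifs with hn
  · have : IsEmpty ((fun H : FiniteIndexSubalgebra p L => subIndex p L H.1) ⁻¹' {n}) :=
      ⟨fun H => H.1.2 (hn ▸ H.2)⟩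
    rw [Nat.card_of_isEmpty, Nat.cast_zero, zero_mul]
  · rw [subalgebraCount]
    congr 2
    refine Nat.card_congr ⟨fun H => ⟨⟨H.1, by rw [H.2]; exact hn⟩, H.2⟩, fun H => ⟨H.1.1, H.2⟩,
      fun _ => rfl, fun _ => rfl⟩

lemma exists_tendsto_of_summable {s : ℂ} (hs : Summable (zetaTerm p L s)) :
    ∃ l : ℂ, Tendsto (fun N : ℕ => ∑ n ∈ Finset.Icc 1 N,
      (subalgebraCount p L n : ℂ) * (n : ℂ) ^ (-s)) atTop (𝓝 l) := by
  refine ⟨_, ((hasSum_subalgebraCount hs).tendsto_sum_nat.comp (tendsto_add_atTop_nat 1)).congr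
    fun N => ?_⟩
  rw [Function.comp_apply, Finset.sum_range_succ', if_pos rfl, add_zero, Finset.range_eq_Ico,
    Finset.sum_Ico_add' (fun n => if n = 0 then (0 : ℂ) else
      (subalgebraCount p L n : ℂ) * (n : ℂ) ^ (-s)) 0 N 1, zero_add]
  refine Finset.sum_congr (by ext; simp) fun n hn => ?_
  rw [if_neg (by have := (Finset.mem_Ico.1 hn).1; omega)]

/-- A nonzero constant is not summable over an infinite type. Finiteness matters because `Nat.card`
of an infinite type is 0, which would spoil the lower bound on the coefficients. -/
lemma finite_subalgebras_of_summable {s : ℂ} (hs : Summable (zetaTerm p L s)) {n : ℕ}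
    (hn : n ≠ 0) : Finite {H : LieSubalgebra ℤ_[p] L // subIndex p L H = n} := by
  by_contra hinf
  rw [not_finite_iff_infinite] at hinf
  let f : {H : LieSubalgebra ℤ_[p] L // subIndex p L H = n} → FiniteIndexSubalgebra p L :=
    fun H => ⟨H.1, by rw [H.2]; exact hn⟩
  have hf : Function.Injective f := fun H H' h =>
    Subtype.ext (congrArg (fun K : FiniteIndexSubalgebra p L => K.1) h)
  have h1 := hs.comp_injective hf
  have h2 : zetaTerm p L s ∘ f = fun _ => (n : ℂ) ^ (-s) := by
    funext H
    rw [Function.comp_apply, zetaTerm, H.2]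
  rw [h2, summable_const_iff] at h1
  exact (Complex.cpow_ne_zero_iff_of_exponent_ne_zero (by
    intro h0; rw [h0] at h1; simp at h1)).2 (Nat.cast_ne_zero.2 hn) h1

/-- With `n = l = 0` the lattice `p^m ℤ_p²` is always compatible, and each of its `p^(2m)` cosets
gives a subalgebra. -/
lemma IsNormalBasis.le_subalgebraCount (hp : 3 ≤ p) {e : Module.Basis (Fin 3) ℤ_[p] L}
    {a d : ℤ_[p]} {ι : ℕ} (h : IsNormalBasis e a ((p : ℤ_[p]) ^ ι) d) {star : Star} {k : ℕ}
    (hd : HasType d star k) (m : ℕ) : p ^ (2 * m) ≤ subalgebraCount p L (p ^ (2 * m)) := by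
  obtain ⟨E, hE⟩ := h.exists_equiv
  have hfin := finite_subalgebras_of_summable (h.zeta hp hd (s := 2) (by simp)).1
    (pow_ne_zero (2 * m) (NeZero.ne p))
  have hcard := card_subalgebraFiber d ι 0 m 0
  rw [compatCount_of_le d (Nat.zero_le _), card_projPoint_zero, one_mul, add_zero] at hcard
  refine hcard.symm.le.trans ?_
  rw [subalgebraCount]
  refine Nat.card_le_card_of_injective (fun x => ⟨(E ⟨(0, m, 0), x⟩).1, by rw [hE]; simp⟩)
    fun x x' hx => ?_
  have h0 : (E ⟨(0, m, 0), x⟩).1 = (E ⟨(0, m, 0), x'⟩).1 := congrArg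
    (fun H : {H : LieSubalgebra ℤ_[p] L // subIndex p L H = p ^ (2 * m)} => H.1) hx
  have h1 : E ⟨(0, m, 0), x⟩ = E ⟨(0, m, 0), x'⟩ := Subtype.ext h0
  exact eq_of_heq (Sigma.mk.inj (E.injective h1)).2

lemma IsNormalBasis.isAbscissa (hp : 3 ≤ p) {e : Module.Basis (Fin 3) ℤ_[p] L}
    {a d : ℤ_[p]} {ι : ℕ} (h : IsNormalBasis e a ((p : ℤ_[p]) ^ ι) d) {star : Star} {k : ℕ}
    (hd : HasType d star k) :
    IsAbscissaOfConvergence (fun n => (subalgebraCount p L n : ℂ)) 1 := by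
  refine ⟨fun s hs => exists_tendsto_of_summable (h.zeta hp hd hs).1, ?_⟩
  rintro s hs ⟨l, hl⟩
  have h1 := (hl.comp (tendsto_add_atTop_nat 1)).sub hl
  have h2 : Tendsto (fun N : ℕ => (subalgebraCount p L (N + 1) : ℂ) * ((N + 1 : ℕ) : ℂ) ^ (-s))
      atTop (𝓝 0) := by
    rw [sub_self] at h1
    refine h1.congr fun N => ?_
    rw [Function.comp_apply, Finset.sum_Icc_succ_top (by omega), add_sub_cancel_left]
  have h3 : Tendsto (fun m : ℕ => p ^ (2 * m) - 1) atTop atTop := by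
    refine (tendsto_sub_atTop_nat 1).comp
      ((tendsto_pow_atTop_atTop_of_one_lt (Fact.out : p.Prime).one_lt).comp ?_)
    exact tendsto_id.const_mul_atTop' (by norm_num)
  have h4 := (h2.comp h3).norm
  rw [norm_zero] at h4
  -- Convergence would make the terms tend to 0, but those at `p^(2m)` have norm at least
  -- `(p^(2m))^(1 - Re s) ≥ 1`.
  have h5 : (1 : ℝ) ≤ 0 := by
    refine ge_of_tendsto' h4 fun m => ?_
    have hpos : 0 < p ^ (2 * m) := pow_pos (NeZero.pos p) _
    have hpos' : (0 : ℝ) < ((p ^ (2 * m) : ℕ) : ℝ) := Nat.cast_pos.2 hpos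
    have h1le : (1 : ℝ) ≤ ((p ^ (2 * m) : ℕ) : ℝ) := by exact_mod_cast hpos
    rw [Function.comp_apply, Nat.sub_add_cancel hpos, norm_mul, Complex.norm_natCast,
      Complex.norm_natCast_cpow_of_pos hpos, Complex.neg_re]
    calc (1 : ℝ) ≤ ((p ^ (2 * m) : ℕ) : ℝ) ^ (1 - s.re) :=
          Real.one_le_rpow h1le (by linarith)
      _ = ((p ^ (2 * m) : ℕ) : ℝ) * ((p ^ (2 * m) : ℕ) : ℝ) ^ (-s.re) := by
          rw [sub_eq_add_neg, Real.rpow_add hpos', Real.rpow_one]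
      _ ≤ _ := by
          gcongr
          exact h.le_subalgebraCount hp hd m
  linarith

end Abscissa

/-! ### Meromorphic continuation and the order of the pole at `s = 1` -/

section Meromorphy

variable {p : ℕ} [Fact p.Prime]

lemma analyticAt_p_cpow_neg (x : ℂ) : AnalyticAt ℂ (fun s : ℂ => (p : ℂ) ^ (-s)) x := by
  have : (fun s : ℂ => (p : ℂ) ^ (-s)) = fun s => Complex.exp (Complex.log p * (-s)) := by
    funext s
    rw [Complex.cpow_def_of_ne_zero p_cast_ne_zero]
  rw [this]
  fun_prop

/-- The function `p^(2-s) - 1` is entire and takes the nonzero value `p - 1` at `s = 1`, so its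
zeros are isolated. -/
lemma cpow_two_sub_ne_one_mem_codiscrete : {s : ℂ | (p : ℂ) ^ (2 - s) ≠ 1} ∈ codiscrete ℂ := by
  have ha : AnalyticOnNhd ℂ (fun s : ℂ => (p : ℂ) ^ (2 - s) - 1) Set.univ := fun x _ => by
    simp_rw [cpow_two_sub]
    have := analyticAt_p_cpow_neg (p := p) x
    fun_prop
  have h := AnalyticOnNhd.preimage_zero_mem_codiscrete (x := 1) ha (by
    simp only [ne_eq]
    norm_num
    rw [sub_eq_zero]
    exact_mod_cast (Fact.out : p.Prime).one_lt.ne')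
  convert h using 1
  ext s
  simp [sub_eq_zero]

lemma explicitZ_add_two_apply (star : Star) (k : ℕ) (s : ℂ) : explicitZ p star (k + 2) (s - 2) =
    (p : ℂ)⁻¹ * (p * (p * (p : ℂ) ^ (-s))) ^ 2 * explicitZ p star k (s - 2) +
      (1 - (p : ℂ)⁻¹) := by
  rw [explicitZ, neg_sub, cpow_two_sub]
  ring

lemma explicitZ_one_apply (star : Star) (s : ℂ) : explicitZ p star 1 (s - 2) =
    (1 - (p : ℂ)⁻¹) * (1 - p * (p : ℂ) ^ (-s))⁻¹ := by
  have hp0 := p_cast_ne_zero (p := p)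
  rw [explicitZ, neg_sub, cpow_two_sub, inv_mul_cancel_left₀ hp0, div_eq_mul_inv]

lemma explicitZ_square_apply (s : ℂ) : explicitZ p .square 0 (s - 2) =
    (1 - (p : ℂ)⁻¹) ^ 2 * ((1 - p * (p : ℂ) ^ (-s))⁻¹ * (1 - p * (p : ℂ) ^ (-s))⁻¹) := by
  have hp0 := p_cast_ne_zero (p := p)
  rw [explicitZ, neg_sub, cpow_two_sub]
  rw [inv_mul_cancel_left₀ hp0, div_pow, div_eq_mul_inv, sq (1 - _ * _), mul_inv]

lemma explicitZ_nonsquare_apply (s : ℂ) : explicitZ p .nonsquare 0 (s - 2) =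
    (1 - ((p : ℂ) ^ 2)⁻¹) * (1 + p * (p : ℂ) ^ (-s))⁻¹ * (1 - p * (p : ℂ) ^ (-s))⁻¹ := by
  have hp0 := p_cast_ne_zero (p := p)
  rw [explicitZ, neg_sub, cpow_two_sub]
  rw [mul_pow (p : ℂ), inv_mul_cancel_left₀ (pow_ne_zero 2 hp0), div_eq_mul_inv, mul_assoc,
    ← mul_inv]
  congr 2
  ring

lemma meromorphicAt_explicitZ (star : Star) (k : ℕ) (x : ℂ) :
    MeromorphicAt (fun s => explicitZ p star k (s - 2)) x := by
  have ha := (analyticAt_p_cpow_neg (p := p) x).meromorphicAt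
  induction k using Nat.strong_induction_on with
  | _ k ih =>
    match k with
    | 0 =>
      cases star
      · simp_rw [explicitZ_square_apply]; fun_prop
      · simp_rw [explicitZ_nonsquare_apply]; fun_prop
    | 1 => simp_rw [explicitZ_one_apply]; fun_prop
    | k + 2 =>
      have := ih k (by omega)
      simp_rw [explicitZ_add_two_apply]
      fun_prop

/-- The zeta formula as a rational function in `p^{-s}` and `Z_{∗,k}`. -/
lemma zetaFormula_apply (star : Star) (k ι : ℕ) (s : ℂ) : zetaFormula p star k ι s =
    ((1 - (p : ℂ) ^ (-s))⁻¹ * (1 - p * (p * (p : ℂ) ^ (-s)))⁻¹) * (1 - p * (p : ℂ) ^ (-s))⁻¹ +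
    (-((1 + p * (p : ℂ) ^ (-s))⁻¹ * (1 - p * (p * (p : ℂ) ^ (-s)))⁻¹ *
      (p * (p * (p : ℂ) ^ (-s))) ^ (ι + 1) * (1 - (p : ℂ)⁻¹)⁻¹)) *
      (explicitZ p star k (s - 2) * (1 - p * (p : ℂ) ^ (-s))⁻¹) := by
  have hpow : (p : ℂ) ^ ((2 - s) * ((ι : ℂ) + 1)) = (p * (p * (p : ℂ) ^ (-s))) ^ (ι + 1) := by
    rw [mul_comm, ← cpow_two_sub, ← Complex.cpow_nat_mul]
    push_cast
    rfl
  rw [zetaFormula, abelianZeta, localZeta_sub_one, localZeta_sub_two, localZeta_two_mul_sub_two,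
    localZeta, hpow, show 1 - ((p : ℂ) * (p : ℂ) ^ (-s)) ^ 2 =
      (1 + p * (p : ℂ) ^ (-s)) * (1 - p * (p : ℂ) ^ (-s)) by ring, mul_inv]
  ring

lemma meromorphic_zetaFormula (star : Star) (k ι : ℕ) : Meromorphic (zetaFormula p star k ι) := by
  intro x
  have ha := (analyticAt_p_cpow_neg (p := p) x).meromorphicAt
  have hZ := meromorphicAt_explicitZ (p := p) star k x
  have : zetaFormula p star k ι = _ := funext fun s => zetaFormula_apply star k ι s
  rw [this]
  fun_prop

lemma p_cpow_neg_one : (p : ℂ) * (p : ℂ) ^ (-(1 : ℂ)) = 1 := by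
  rw [Complex.cpow_neg_one, mul_inv_cancel₀ p_cast_ne_zero]

/-- `1 - p^(1-s)` has a simple zero at 1, its derivative there being `log p`. Every pole at `s = 1`
comes from this factor. -/
lemma order_inv_one_sub :
    meromorphicOrderAt (fun s : ℂ => (1 - (p : ℂ) * (p : ℂ) ^ (-s))⁻¹) 1 = ((-1 : ℤ) : WithTop ℤ) := by
  have ha : AnalyticAt ℂ (fun s : ℂ => 1 - (p : ℂ) * (p : ℂ) ^ (-s)) 1 := by
    have := analyticAt_p_cpow_neg (p := p) 1
    fun_prop
  have hd : HasDerivAt (fun s : ℂ => 1 - (p : ℂ) * (p : ℂ) ^ (-s)) (Complex.log p) 1 := by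
    have h1 := (((hasDerivAt_id (1 : ℂ)).neg).const_cpow (c := (p : ℂ))
      (Or.inl p_cast_ne_zero)).const_mul (p : ℂ)
    have h2 := h1.const_sub 1
    convert! h2 using 1
    simp only [id, Pi.neg_apply]
    rw [← mul_assoc, ← mul_assoc, p_cpow_neg_one]
    ring
  have hlog : Complex.log p ≠ 0 := by
    rw [← Complex.ofReal_natCast, ← Complex.ofReal_log (by positivity)]
    exact_mod_cast (Real.log_pos one_lt_p).ne'
  have h1 := ha.analyticOrderAt_eq_one_of_zero_deriv_ne_zero (by rw [p_cpow_neg_one, sub_self])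
    (by rw [hd.deriv]; exact hlog)
  rw [fun_meromorphicOrderAt_inv, ha.meromorphicOrderAt_eq, h1]
  rfl

lemma order_mul_of_ne_zero {f g : ℂ → ℂ} {x : ℂ} (hg : AnalyticAt ℂ g x) (hg' : g x ≠ 0) :
    meromorphicOrderAt (fun s => g s * f s) x = meromorphicOrderAt f x :=
  meromorphicOrderAt_mul_of_ne_zero hg hg'

/-- The order of `Z_{∗,k}(s - 2)` at `s = 1`. -/
def explicitZOrder (star : Star) (k : ℕ) : ℤ :=
  match star with
  | .square => if Even k then -2 else -1
  | .nonsquare => -1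

lemma explicitZOrder_neg (star : Star) (k : ℕ) : explicitZOrder star k < 0 := by
  cases star
  · rw [explicitZOrder]; split_ifs <;> norm_num
  · rw [explicitZOrder]; norm_num

lemma p_sub_one_ne_zero : (1 : ℂ) - p ≠ 0 := by
  rw [sub_ne_zero]
  exact_mod_cast (Fact.out : p.Prime).one_lt.ne

lemma order_explicitZ (star : Star) (k : ℕ) :
    meromorphicOrderAt (fun s => explicitZ p star k (s - 2)) 1 =
      (explicitZOrder star k : WithTop ℤ) := by
  have ha := analyticAt_p_cpow_neg (p := p) 1
  have hX := order_inv_one_sub (p := p)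
  have hXm : MeromorphicAt (fun s : ℂ => (1 - (p : ℂ) * (p : ℂ) ^ (-s))⁻¹) 1 := by
    have := ha.meromorphicAt
    fun_prop
  have hp0 := p_cast_ne_zero (p := p)
  induction k using Nat.strong_induction_on with
  | _ k ih =>
    match k with
    | 0 =>
      cases star
      · simp_rw [explicitZ_square_apply]
        rw [order_mul_of_ne_zero (g := fun _ => (1 - (p : ℂ)⁻¹) ^ 2) (by fun_prop)
            (pow_ne_zero 2 one_sub_p_inv_ne_zero),
          fun_meromorphicOrderAt_mul hXm hXm, hX, explicitZOrder, if_pos Even.zero]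
        rfl
      · simp_rw [explicitZ_nonsquare_apply]
        have h1 : (1 : ℂ) + p * (p : ℂ) ^ (-(1 : ℂ)) ≠ 0 := by
          rw [p_cpow_neg_one]; norm_num
        rw [order_mul_of_ne_zero ?_ ?_, hX, explicitZOrder]
        · have : AnalyticAt ℂ (fun s : ℂ => (1 + (p : ℂ) * (p : ℂ) ^ (-s))⁻¹) 1 :=
            AnalyticAt.fun_inv (by fun_prop) h1
          fun_prop
        · refine mul_ne_zero ?_ (inv_ne_zero h1)
          rw [← inv_pow, show (1 : ℂ) - (p : ℂ)⁻¹ ^ 2 = (1 - (p : ℂ)⁻¹) * (1 + (p : ℂ)⁻¹) by ring]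
          refine mul_ne_zero one_sub_p_inv_ne_zero ?_
          have : (p : ℂ) + 1 ≠ 0 := by exact_mod_cast Nat.succ_ne_zero p
          intro h0
          apply this
          field_simp at h0
          linear_combination h0
    | 1 =>
      simp_rw [explicitZ_one_apply]
      rw [order_mul_of_ne_zero (g := fun _ => 1 - (p : ℂ)⁻¹) (by fun_prop) one_sub_p_inv_ne_zero, hX]
      cases star <;> rfl
    | k + 2 =>
      have hk := ih k (by omega)
      have he : explicitZOrder star (k + 2) = explicitZOrder star k := by
        cases star
        · rw [explicitZOrder, explicitZOrder]
          simp [Nat.even_add]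
        · rfl
      have h1 : meromorphicOrderAt (fun s : ℂ => (p : ℂ)⁻¹ * (p * (p * (p : ℂ) ^ (-s))) ^ 2 *
          explicitZ p star k (s - 2)) 1 = (explicitZOrder star k : WithTop ℤ) := by
        rw [order_mul_of_ne_zero (by fun_prop) ?_, hk]
        rw [p_cpow_neg_one, mul_one]
        exact mul_ne_zero (inv_ne_zero hp0) (pow_ne_zero 2 hp0)
      have h2 : meromorphicOrderAt (fun _ : ℂ => (1 - (p : ℂ)⁻¹)) 1 = 0 := by
        rw [meromorphicOrderAt_const, if_neg one_sub_p_inv_ne_zero]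
      simp_rw [explicitZ_add_two_apply]
      rw [he, ← h1]
      -- Adding a nonzero constant, of order 0, does not affect a pole.
      refine meromorphicOrderAt_add_eq_left_of_lt (by fun_prop) ?_
      rw [h1, h2]
      exact_mod_cast explicitZOrder_neg star k

lemma order_zetaFormula (star : Star) (k ι : ℕ) :
    meromorphicOrderAt (zetaFormula p star k ι) 1 =
      ((explicitZOrder star k - 1 : ℤ) : WithTop ℤ) := by
  have ha := analyticAt_p_cpow_neg (p := p) 1
  have hX := order_inv_one_sub (p := p)
  have hXm : MeromorphicAt (fun s : ℂ => (1 - (p : ℂ) * (p : ℂ) ^ (-s))⁻¹) 1 := by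
    have := ha.meromorphicAt
    fun_prop
  have hp0 := p_cast_ne_zero (p := p)
  have hT : (1 : ℂ) - (p : ℂ) ^ (-(1 : ℂ)) ≠ 0 := by
    rw [Complex.cpow_neg_one]; exact one_sub_p_inv_ne_zero
  have hY : (1 : ℂ) - p * (p * (p : ℂ) ^ (-(1 : ℂ))) ≠ 0 := by
    rw [p_cpow_neg_one, mul_one]; exact p_sub_one_ne_zero
  have hX' : (1 : ℂ) + p * (p : ℂ) ^ (-(1 : ℂ)) ≠ 0 := by
    rw [p_cpow_neg_one]; norm_num
  have aT : AnalyticAt ℂ (fun s : ℂ => (1 - (p : ℂ) ^ (-s))⁻¹) 1 :=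
    AnalyticAt.fun_inv (by fun_prop) hT
  have aY : AnalyticAt ℂ (fun s : ℂ => (1 - (p : ℂ) * (p * (p : ℂ) ^ (-s)))⁻¹) 1 :=
    AnalyticAt.fun_inv (by fun_prop) hY
  have aX : AnalyticAt ℂ (fun s : ℂ => (1 + (p : ℂ) * (p : ℂ) ^ (-s))⁻¹) 1 :=
    AnalyticAt.fun_inv (by fun_prop) hX'
  have h1 : meromorphicOrderAt (fun s : ℂ => ((1 - (p : ℂ) ^ (-s))⁻¹ *
      (1 - p * (p * (p : ℂ) ^ (-s)))⁻¹) * (1 - p * (p : ℂ) ^ (-s))⁻¹) 1 =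
      ((-1 : ℤ) : WithTop ℤ) := by
    rw [order_mul_of_ne_zero (aT.fun_mul aY) (mul_ne_zero (inv_ne_zero hT) (inv_ne_zero hY)), hX]
  have h2 : meromorphicOrderAt (fun s : ℂ =>
      (-((1 + p * (p : ℂ) ^ (-s))⁻¹ * (1 - p * (p * (p : ℂ) ^ (-s)))⁻¹ *
      (p * (p * (p : ℂ) ^ (-s))) ^ (ι + 1) * (1 - (p : ℂ)⁻¹)⁻¹)) *
      (explicitZ p star k (s - 2) * (1 - p * (p : ℂ) ^ (-s))⁻¹)) 1 =
      ((explicitZOrder star k - 1 : ℤ) : WithTop ℤ) := by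
    rw [order_mul_of_ne_zero (by fun_prop) ?_,
      fun_meromorphicOrderAt_mul (meromorphicAt_explicitZ star k 1) hXm, hX, order_explicitZ]
    · rfl
    · refine neg_ne_zero.2 (mul_ne_zero (mul_ne_zero (mul_ne_zero (inv_ne_zero hX')
        (inv_ne_zero hY)) (pow_ne_zero _ ?_)) (inv_ne_zero one_sub_p_inv_ne_zero))
      rw [p_cpow_neg_one, mul_one]
      exact hp0
  have : zetaFormula p star k ι = _ := funext fun s => zetaFormula_apply star k ι s
  rw [this, ← h2]
  -- The abelian part has order -1 and the correction at most -2, so the correction decides.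
  refine meromorphicOrderAt_add_eq_right_of_lt ?_ ?_
  · have := ha.meromorphicAt
    fun_prop
  · rw [h1, h2]
    have := explicitZOrder_neg star k
    exact_mod_cast (by omega : explicitZOrder star k - 1 < -1)

end Meromorphy

end

end PadicLie

/-! ### The theorem -/

theorem mainTheorem3 (p : ℕ) [Fact p.Prime] (hp : 3 ≤ p)
    (φ : PadicLie.SolubleFamily p) (hφ : φ.Nondegenerate) (i : ℕ)
    (L : Type*) [LieRing L] [LieAlgebra ℤ_[p] L] (hL : φ.IsMember i L) :
    ∃ (star : PadicLie.Star) (k ι : ℕ),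
      -- the quadratic form of `L` is `p^ι (x₂² - d x₃²)` in a suitable basis, `d` of type `(∗, k)`
      (∃ (e : Module.Basis (Fin 3) ℤ_[p] L) (d : ℤ_[p]), PadicLie.HasType d star k ∧
        PadicLie.ternaryForm e = MvPolynomial.C ((p : ℤ_[p]) ^ ι) *
          (MvPolynomial.X 1 ^ 2 - MvPolynomial.C d * MvPolynomial.X 2 ^ 2)) ∧
      -- `Z_{∗,k}` is Igusa's local zeta function of `x² - d y²`, for each `d` of type `(∗, k)`
      (∀ d : ℤ_[p], PadicLie.HasType d star k → ∀ s : ℂ, -1 < s.re →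
        Integrable (PadicLie.igusaIntegrand (PadicLie.binaryForm d) s) (PadicLie.haarPow p 2) ∧
        PadicLie.igusaZeta (PadicLie.binaryForm d) s = PadicLie.explicitZ p star k s) ∧
      -- the abscissa of convergence is `1`
      PadicLie.IsAbscissaOfConvergence (fun n => (PadicLie.subalgebraCount p L n : ℂ)) 1 ∧
      (∀ s : ℂ, 1 < s.re → Summable (PadicLie.zetaTerm p L s)) ∧
      -- the formula on the half-plane of convergence, away from the zeros of `1 - p^{2-s}`
      (∀ s : ℂ, 1 < s.re → (p : ℂ) ^ (2 - s) ≠ 1 →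
        PadicLie.subalgebraZeta p L s = PadicLie.zetaFormula p star k ι s) ∧
      -- the meromorphic continuation, the formula for it, and its pole at `s = 1`
      ∃ F : ℂ → ℂ, Meromorphic F ∧
        (∀ s : ℂ, 1 < s.re → F s = PadicLie.subalgebraZeta p L s) ∧
        F =ᶠ[codiscrete ℂ] PadicLie.zetaFormula p star k ι ∧
        (star = PadicLie.Star.square ∧ Even k → meromorphicOrderAt F 1 = ((-3 : ℤ) : WithTop ℤ)) ∧
        (¬ (star = PadicLie.Star.square ∧ Even k) →
          meromorphicOrderAt F 1 = ((-2 : ℤ) : WithTop ℤ)) := by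
  classical
  obtain ⟨e, a, d, star, k, ι, hd, he⟩ := hL.exists_normalBasis hp hφ
  have hformula : ∀ s : ℂ, 1 < s.re → (p : ℂ) ^ (2 - s) ≠ 1 →
      PadicLie.subalgebraZeta p L s = PadicLie.zetaFormula p star k ι s :=
    fun s hs => (he.zeta hp hd hs).2
  -- At zeros of `1 - p^(2-s)` in the half-plane the literal formula involves division by zero,
  -- which gives 0. Gluing in the series itself makes `F` agree with the zeta function there too,
  -- and changes the formula only on a set with codiscrete complement.
  set F : ℂ → ℂ := fun s =>
    if 1 < s.re then PadicLie.subalgebraZeta p L s else PadicLie.zetaFormula p star k ι s with hF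
  have hFeq : F =ᶠ[codiscrete ℂ] PadicLie.zetaFormula p star k ι := by
    filter_upwards [PadicLie.cpow_two_sub_ne_one_mem_codiscrete (p := p)] with s hs
    by_cases h1 : 1 < s.re
    · exact (if_pos h1).trans (hformula s h1 hs)
    · exact if_neg h1
  have hord : meromorphicOrderAt F 1 =
      ((PadicLie.explicitZOrder star k - 1 : ℤ) : WithTop ℤ) := by
    rw [← PadicLie.order_zetaFormula (p := p) star k ι]
    -- The order depends only on values near 1 and away from 1, where codiscrete agreement suffices.
    refine meromorphicOrderAt_congr ?_
    have := mem_codiscrete.1 hFeq 1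
    rw [disjoint_principal_right, compl_compl] at this
    exact this
  refine ⟨star, k, ι, ⟨e, d, hd, he.ternaryForm_eq⟩, fun d' hd' s hs => hd'.igusa hp hs,
    he.isAbscissa hp hd, fun s hs => (he.zeta hp hd hs).1, hformula, F,
    (PadicLie.meromorphic_zetaFormula star k ι).congr_codiscrete hFeq.symm,
    fun s hs => if_pos hs, hFeq, ?_, ?_⟩
  · rintro ⟨rfl, hk⟩
    rw [hord, PadicLie.explicitZOrder, if_pos hk]
    rfl
  · intro hn
    rw [hord]
    cases star
    · rw [PadicLie.explicitZOrder, if_neg fun hk => hn ⟨rfl, hk⟩]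
      rfl
    · rfl
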